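/- Let $d\ge 0$ and $D=2d$. A full-dimensional convex polytope in $\mathbb R^{D}$ is \emph{neighbourly} if any $d$ of its vertices are the vertex set of a face. A \emph{plane diagram} is a finite collection of black and white points affinely spanning the plane. An \emph{affine Gale diagram} of a polytope in $\mathbb R^{D}$ with $D+4$ vertices is a plane diagram obtained from a Gale transform of its vertices (a family of vectors in $\mathbb R^3$, indexed by the vertices) by central projection from the origin to an affine plane $\{\ell=1\}$, where $\ell$ is a linear functional that does not vanish on any of the vectors; a point is black if $\ell>0$ on the corresponding vector and white if $\ell<0$. Thus its points correspond bijectively to the vertices of the polytope. A \emph{T-diagram} is a plane diagram with $D+4$ points, exactly $d+3$ of them black, the black points being in convex position, which is an affine Gale diagram of a neighbourly polytope in $\mathbb R^{D}$. A \emph{T-polytope} is a neighbourly polytope that has a T-diagram as an affine Gale diagram. Two polytopes are combinatorially equivalent if there is a bijection between their vertices under which the vertex sets of faces correspond to each other (a combinatorial isomorphism). A combinatorial equivalence of plane diagrams is a bijection between their points that preserves colours, preserves the relation ``lies between'', and either preserves the orientations of all triples or reverses all of them. An equivalence by diagonals of two T-diagrams is a bijection $\varphi$ between their points that preserves colours and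 the unoriented cyclic order of the black points along the boundary of their convex hull, and such that a white point $B$ lies in the convex hull of a set of consecutive black points $A_i$ if and only if $\varphi(B)$ lies in the convex hull of the points $\varphi(A_i)$. \textbf{Theorem.} Let $P\subset\mathbb R^{D}$ and $Q\subset\mathbb R^{E}$ be T-polytopes, and let $X$ and $Y$ be T-diagrams that are affine Gale diagrams of $P$ and $Q$ respectively. (1) If $P$ and $Q$ are combinatorially equivalent, then $X$ and $Y$ are combinatorially equivalent (as diagrams with coloured points), and also equivalent by diagonals. (2) Conversely, every equivalence by diagonals between $X$ and $Y$ induces a combinatorial isomorphism between $P$ and $Q$; in particular, the class of $X$ under equivalence by diagonals determines the combinatorial type of $P$. (3) If $D\ge 4$, then every combinatorial isomorphism from $P$ to $Q$ induces, through the bijections between vertices and points of the diagrams, a combinatorial equivalence from $X$ to $Y$, which is also an equivalence by diagonals. In particular, the colour of the point corresponding to each vertex is determined by the combinatorics of the polytope. -/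

import Mathlib

open Set

/-! ### Polytopes given by the family of their vertices -/

/-- `p` is the family of vertices (without repetition) of a full-dimensional convex polytope in
`ℝ ^ D`, namely of `convexHull ℝ (range p)`. -/
def IsPolytopeVertices {ι : Type*} {D : ℕ} (p : ι → Fin D → ℝ) : Prop :=
  Finite ι ∧ ConvexIndependent ℝ p ∧ affineSpan ℝ (range p) = ⊤

/-- `M` is (the set of labels of) the vertex set of a face of the polytope with vertices `p`.
The empty face and the whole polytope are counted as faces. -/
def IsFaceVertexSet {ι : Type*} {D : ℕ} (p : ι → Fin D → ℝ) (M : Set ι) : Prop :=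
  ∃ F : Set (Fin D → ℝ), IsExposed ℝ (convexHull ℝ (range p)) F ∧ M = {i | p i ∈ F}

/-- The bijection `σ` between the vertices is a combinatorial isomorphism of polytopes: vertex
sets of faces correspond to vertex sets of faces. -/
def IsPolytopeIso {ι κ : Type*} {D E : ℕ} (p : ι → Fin D → ℝ) (q : κ → Fin E → ℝ)
    (σ : ι ≃ κ) : Prop :=
  ∀ M : Set ι, IsFaceVertexSet p M ↔ IsFaceVertexSet q (σ '' M)

/-- `p` is the family of vertices of a neighbourly polytope in `ℝ ^ (2 d)`: any `d` vertices are
the vertices of a face. -/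
def IsNeighborlyPolytope {ι : Type*} (d : ℕ) (p : ι → Fin (2 * d) → ℝ) : Prop :=
  IsPolytopeVertices p ∧ ∀ M : Finset ι, M.card = d → IsFaceVertexSet p (M : Set ι)

/-! ### Plane diagrams of black and white points -/

/-- A plane diagram: a labelled collection of points affinely spanning the plane, each of which is
black or white (the points with label outside `black` are the white ones). -/
structure PlaneDiagram (ι : Type*) where
  point : ι → Fin 2 → ℝ
  black : Set ι
  spanning : affineSpan ℝ (range point) = ⊤

/-- The orientation of a triple of points of a diagram: `1` for counterclockwise, `-1` for
clockwise, `0` for collinear. -/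
noncomputable def PlaneDiagram.orient {ι : Type*} (X : PlaneDiagram ι) (i j k : ι) : SignType :=
  SignType.sign
    ((X.point j 0 - X.point i 0) * (X.point k 1 - X.point i 1)
      - (X.point j 1 - X.point i 1) * (X.point k 0 - X.point i 0))

/-- The bijection `σ` is a combinatorial equivalence of plane diagrams: it preserves colours, the
orientations of triples (up to a mirror symmetry, that is, it preserves all of them or reverses all
of them), and the relation "lies between". -/
def IsDiagramIso {ι κ : Type*} (X : PlaneDiagram ι) (Y : PlaneDiagram κ) (σ : ι ≃ κ) : Prop :=
  (∀ i, σ i ∈ Y.black ↔ i ∈ X.black) ∧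
  ((∀ i j k, Y.orient (σ i) (σ j) (σ k) = X.orient i j k) ∨
    (∀ i j k, Y.orient (σ i) (σ j) (σ k) = -X.orient i j k)) ∧
  (∀ i j k, Wbtw ℝ (Y.point (σ i)) (Y.point (σ j)) (Y.point (σ k)) ↔
    Wbtw ℝ (X.point i) (X.point j) (X.point k))

/-- `A 0, A 1, …, A (n - 1)` are all the black points (assumed to be in convex position), each
listed once, in the order in which they are met along the boundary of their convex hull, in one of
the two directions. -/
def IsBoundaryNumbering {ι : Type*} (X : PlaneDiagram ι) {n : ℕ} (A : Fin n → ι) : Prop :=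
  Function.Injective A ∧ range A = X.black ∧
  ((∀ i j k, i < j → j < k → X.orient (A i) (A j) (A k) = 1) ∨
    (∀ i j k, i < j → j < k → X.orient (A i) (A j) (A k) = -1))

/-- The bijection `σ` is an equivalence by diagonals: it preserves colours and the unoriented
cyclic order of the black points, and a white point lies in the convex hull of a run of consecutive
black points iff its image lies in the convex hull of the images of these. (As the boundary
numbering may start anywhere, every run of consecutive black points is `A 0, …, A m` for some
boundary numbering `A`.) -/
def IsDiagonalIso {ι κ : Type*} (X : PlaneDiagram ι) (Y : PlaneDiagram κ) (σ : ι ≃ κ) : Prop :=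
  (∀ i, σ i ∈ Y.black ↔ i ∈ X.black) ∧
  (∀ (n : ℕ) (A : Fin n → ι), IsBoundaryNumbering X A ↔ IsBoundaryNumbering Y (σ ∘ A)) ∧
  (∀ (n : ℕ) (A : Fin n → ι), IsBoundaryNumbering X A → ∀ (m : Fin n), ∀ b ∉ X.black,
    (X.point b ∈ convexHull ℝ (X.point '' (A '' Iic m)) ↔
      Y.point (σ b) ∈ convexHull ℝ (Y.point '' (σ '' (A '' Iic m)))))

/-! ### Gale diagrams -/

/-- `g` is a Gale transform (vector Gale diagram) of the configuration `p`: the `m` coordinate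
functions `i ↦ g i k` form a basis of the space of affine dependences of `p`. -/
def IsGaleTransform {ι : Type*} [Fintype ι] {D m : ℕ} (p : ι → Fin D → ℝ)
    (g : ι → Fin m → ℝ) : Prop :=
  LinearIndependent ℝ (fun (k : Fin m) (i : ι) => g i k) ∧
  ∀ c : ι → ℝ, c ∈ Submodule.span ℝ (range fun (k : Fin m) (i : ι) => g i k) ↔
    ∑ i, c i = 0 ∧ ∑ i, c i • p i = 0

/-- `X` is a (plane) affine Gale diagram of the configuration `p`, the point of `X` corresponding
to `p i` being the one with label `i`: it is the central projection of a Gale transform `g` of `p`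
to a plane `{v | ℓ v = 1}`, identified with `ℝ ^ 2` by an affine coordinate system `φ`; the black
points are the projections of the vectors on the positive side, the white ones of those on the
negative side. -/
def IsAffineGaleDiagram {ι : Type*} [Fintype ι] {D : ℕ} (p : ι → Fin D → ℝ)
    (X : PlaneDiagram ι) : Prop :=
  ∃ g : ι → Fin 3 → ℝ, IsGaleTransform p g ∧
    ∃ (ℓ : (Fin 3 → ℝ) →ₗ[ℝ] ℝ) (φ : (Fin 2 → ℝ) →ᵃ[ℝ] (Fin 3 → ℝ)),
      Function.Injective φ ∧ range φ = {v | ℓ v = 1} ∧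
      ∀ i, ℓ (g i) ≠ 0 ∧ φ (X.point i) = (ℓ (g i))⁻¹ • g i ∧ (i ∈ X.black ↔ 0 < ℓ (g i))

/-- `X` is a T-diagram (for dimension `2 d`): it has `2 d + 4` points, exactly `d + 3` of them are
black and these are in convex position, and it is a Gale diagram of a neighbourly polytope in
`ℝ ^ (2 d)`. -/
def IsTDiagram {ι : Type*} [Fintype ι] (d : ℕ) (X : PlaneDiagram ι) : Prop :=
  Nat.card ι = 2 * d + 4 ∧ X.black.ncard = d + 3 ∧
  ConvexIndependent ℝ (fun i : X.black => X.point i) ∧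
  ∃ p : ι → Fin (2 * d) → ℝ, IsNeighborlyPolytope d p ∧ IsAffineGaleDiagram p X

/-- `p` is the family of vertices of a T-polytope in `ℝ ^ (2 d)`, and `X` is a T-diagram of it. -/
def IsTPolytopeWithDiagram {ι : Type*} [Fintype ι] (d : ℕ) (p : ι → Fin (2 * d) → ℝ)
    (X : PlaneDiagram ι) : Prop :=
  IsNeighborlyPolytope d p ∧ IsTDiagram d X ∧ IsAffineGaleDiagram p X

/-!
The combinatorics of a T-diagram is studied through the vectors `g i` of the Gale transform in
`ℝ ^ 3`; orientations of triples of points are signs of determinants of these vectors, corrected by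
the colours.

Since the polytope is neighbourly, every open half-space bounded by a plane through the origin
contains at least `d + 1` of the `2 d + 4` vectors (`IsBalanced`,
`isBalanced_of_isNeighborlyPolytope`). In particular any three of the vectors are independent. The
vertex sets of faces are the zero sets of nonnegative linear dependences (Gale duality,
`isFaceVertexSet_iff_isGaleFace`); equivalently their complements are unions of cofacets, which have
four elements (`IsBalanced.isGaleFace_iff`). The sets of `d + 1` vertices that are not faces are the
negative sides of the planes that leave exactly `d + 1` vectors on that side
(`IsBalanced.isCut_empty_iff`).

*Rigidity.* The face lattice determines the oriented matroid of `g`. A plane with negative side `A`,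
`|A| = d + 1`, can be moved to pass through the vector `i` outside `A` without changing the other
signs iff `i` can be exchanged with some member of `A`, that is, iff `A - a + i` is again such a
negative side for some `a` (`IsBalanced.isCut_insert_iff`). The proof counts vectors: a plane on its
way cannot have fewer than `d + 1` of them on either side. Applied twice, this recovers the sides of
all planes spanned by two of the vectors, hence all orientations (`exists_sign_bracket`).

*Colours.* In a T-diagram there is, for each black point, a line through it with all other points of
the diagram on one side (`IsTConfig`); this property is respected by isomorphisms.
For `d ≥ 2` a configuration has only one colouring with this property
(`IsTConfig.eq_of_two_le`), so isomorphisms respect colours. Rigidity then gives an equivalence of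
diagrams, and convex hulls of black points are determined by the cofacets.

*Diagonals.* In a T-diagram all white points lie inside the polygon of the black points. So a
white point lies in the convex hull of a run of black points iff it is on the corresponding side of
the diagonal that joins the ends of the run (`IsTConfig.exists_cone_run_iff`). A cofacet consists of
a white point in a triangle of black ones, or of two black and two white points such that the
diagonal through the black ones separates the white ones. So the sides of diagonals determine the
cofacets, and hence the faces (`RespectsDiagonals.isGaleFace_iff`).

For `d = 1` the polytopes are hexagons, whose isomorphisms need not respect colours. But then all
T-diagrams are equivalent, since there is only one possible position of the white points
(`IsTConfig.exists_hexagon`). The case `d = 0` does not occur.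
-/

namespace GaleDiagram

/-! ### Triple products in space -/

/-- The determinant of three vectors of `ℝ ^ 3`. -/
def bracket (a b c : Fin 3 → ℝ) : ℝ :=
  a 0 * (b 1 * c 2 - b 2 * c 1) - a 1 * (b 0 * c 2 - b 2 * c 0) + a 2 * (b 0 * c 1 - b 1 * c 0)

/-- The determinant as a linear functional of its last argument. -/
def bracketL (a b : Fin 3 → ℝ) : (Fin 3 → ℝ) →ₗ[ℝ] ℝ where
  toFun := bracket a b
  map_add' x y := by simp only [bracket, Pi.add_apply]; ring
  map_smul' t x := by simp only [bracket, Pi.smul_apply, smul_eq_mul, RingHom.id_apply]; ring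

@[simp] lemma bracketL_apply (a b c : Fin 3 → ℝ) : bracketL a b c = bracket a b c := rfl

@[simp] lemma bracket_self_left (a b : Fin 3 → ℝ) : bracket a a b = 0 := by
  simp only [bracket]; ring

@[simp] lemma bracket_self_right (a b : Fin 3 → ℝ) : bracket a b b = 0 := by
  simp only [bracket]; ring

@[simp] lemma bracket_self_outer (a b : Fin 3 → ℝ) : bracket a b a = 0 := by
  simp only [bracket]; ring

lemma bracket_swap (a b c : Fin 3 → ℝ) : bracket b a c = -bracket a b c := by
  simp only [bracket]; ring

lemma bracket_swap_right (a b c : Fin 3 → ℝ) : bracket a c b = -bracket a b c := by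
  simp only [bracket]; ring

lemma bracket_rotate (a b c : Fin 3 → ℝ) : bracket b c a = bracket a b c := by
  simp only [bracket]; ring

lemma bracket_smul (r s t : ℝ) (a b c : Fin 3 → ℝ) :
    bracket (r • a) (s • b) (t • c) = r * s * t * bracket a b c := by
  simp only [bracket, Pi.smul_apply, smul_eq_mul]; ring

/-- Cramer's rule: the linear dependence between four vectors of `ℝ ^ 3`. -/
lemma cramer (a b c e : Fin 3 → ℝ) :
    bracket b c e • a - bracket a c e • b + bracket a b e • c - bracket a b c • e = 0 := by
  ext i
  fin_cases i <;>
    simp only [bracket, Pi.add_apply, Pi.sub_apply, Pi.smul_apply, smul_eq_mul, Pi.zero_apply,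
      Fin.zero_eta, Fin.mk_one, Fin.reduceFinMk] <;> ring

/-- Cramer's rule evaluated at a linear functional. -/
lemma cramer_apply (f : (Fin 3 → ℝ) →ₗ[ℝ] ℝ) (a b c e : Fin 3 → ℝ) :
    bracket b c e * f a - bracket a c e * f b + bracket a b e * f c - bracket a b c * f e = 0 := by
  simpa using congrArg f (cramer a b c e)

lemma exists_functional_of_bracket_eq_zero {a b c : Fin 3 → ℝ} (h : bracket a b c = 0) :
    ∃ f : (Fin 3 → ℝ) →ₗ[ℝ] ℝ, f ≠ 0 ∧ f a = 0 ∧ f b = 0 ∧ f c = 0 := by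
  have hdet : (Matrix.of ![a, b, c]).det = 0 := by
    rw [Matrix.det_fin_three, ← h]
    simp only [bracket, Matrix.of_apply, Matrix.cons_val]
    ring
  obtain ⟨v, hv, hMv⟩ := Matrix.exists_mulVec_eq_zero_iff.2 hdet
  refine ⟨Matrix.mulVecLin (Matrix.of ![v]) |> (LinearMap.proj 0).comp, ?_, ?_, ?_, ?_⟩
  · intro h0
    apply hv
    have := congrArg (fun f : (Fin 3 → ℝ) →ₗ[ℝ] ℝ => f v) h0
    simpa [Matrix.mulVec] using this
  · simpa [Matrix.mulVec, dotProduct_comm] using congrFun hMv 0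
  · simpa [Matrix.mulVec, dotProduct_comm] using congrFun hMv 1
  · simpa [Matrix.mulVec, dotProduct_comm] using congrFun hMv 2

/-! ### Balanced configurations -/

section Balanced

variable {ι : Type*} [Fintype ι]

open Classical in
/-- A configuration of `2 d + 4` vectors in `ℝ ^ 3` every open half-space of which contains at
least `d + 1` of the vectors. These are the Gale transforms of the neighbourly polytopes in
`ℝ ^ (2 d)` with `2 d + 4` vertices. -/
def IsBalanced (d : ℕ) (g : ι → Fin 3 → ℝ) : Prop :=
  Fintype.card ι = 2 * d + 4 ∧ ∀ f : (Fin 3 → ℝ) →ₗ[ℝ] ℝ, f ≠ 0 →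
    d + 1 ≤ (Finset.univ.filter fun i => 0 < f (g i)).card

/-- Some linear functional vanishes on the vectors with label in `S`, is negative on those with
label in `A` and positive on all others. -/
def IsCut (g : ι → Fin 3 → ℝ) (S A : Finset ι) : Prop :=
  ∃ f : (Fin 3 → ℝ) →ₗ[ℝ] ℝ, (∀ i ∈ S, f (g i) = 0) ∧ (∀ i ∈ A, f (g i) < 0) ∧
    ∀ i, i ∉ S → i ∉ A → 0 < f (g i)

variable {d : ℕ} {g : ι → Fin 3 → ℝ}

lemma IsBalanced.le_card_of_pos (hg : IsBalanced d g) {f : (Fin 3 → ℝ) →ₗ[ℝ] ℝ} (hf : f ≠ 0)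
    {s : Finset ι} (hs : ∀ i, 0 < f (g i) → i ∈ s) : d + 1 ≤ s.card := by
  classical
  refine (hg.2 f hf).trans (Finset.card_le_card fun i hi => hs i ?_)
  simpa using hi

lemma IsBalanced.le_card_of_neg (hg : IsBalanced d g) {f : (Fin 3 → ℝ) →ₗ[ℝ] ℝ} (hf : f ≠ 0)
    {s : Finset ι} (hs : ∀ i, f (g i) < 0 → i ∈ s) : d + 1 ≤ s.card :=
  hg.le_card_of_pos (f := -f) (neg_ne_zero.2 hf) fun i hi => hs i (by simpa using hi)

/-- At most two vectors of a balanced configuration lie in a plane through the origin. -/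
lemma IsBalanced.card_le_two (hg : IsBalanced d g) {f : (Fin 3 → ℝ) →ₗ[ℝ] ℝ} (hf : f ≠ 0)
    {s : Finset ι} (hs : ∀ i ∈ s, f (g i) = 0) : s.card ≤ 2 := by
  classical
  have h1 := hg.le_card_of_pos hf (s := Finset.univ.filter fun i => 0 < f (g i)) (by simp)
  have h2 := hg.le_card_of_neg hf (s := Finset.univ.filter fun i => f (g i) < 0) (by simp)
  have hd : Disjoint (Finset.univ.filter fun i => 0 < f (g i))
      (Finset.univ.filter fun i => f (g i) < 0) := by
    rw [Finset.disjoint_filter]; intro i _ h; exact h.le.not_gt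
  have hd' : Disjoint s ((Finset.univ.filter fun i => 0 < f (g i)) ∪
      (Finset.univ.filter fun i => f (g i) < 0)) := by
    rw [Finset.disjoint_left]; intro i hi h
    have := hs i hi
    simp [this] at h
  have h3 := Finset.card_le_univ (s ∪ ((Finset.univ.filter fun i => 0 < f (g i)) ∪
      (Finset.univ.filter fun i => f (g i) < 0)))
  rw [Finset.card_union_of_disjoint hd', Finset.card_union_of_disjoint hd, hg.1] at h3
  omega

lemma IsBalanced.false_of_three (hg : IsBalanced d g) {f : (Fin 3 → ℝ) →ₗ[ℝ] ℝ} (hf : f ≠ 0)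
    {i j k : ι} (hij : i ≠ j) (hik : i ≠ k) (hjk : j ≠ k) (hi : f (g i) = 0) (hj : f (g j) = 0)
    (hk : f (g k) = 0) : False := by
  classical
  have := hg.card_le_two hf (s := {i, j, k}) (by simp [hi, hj, hk])
  rw [Finset.card_eq_three.2 ⟨i, j, k, hij, hik, hjk, rfl⟩] at this
  omega

lemma IsBalanced.bracket_ne_zero (hg : IsBalanced d g) {i j k : ι} (hij : i ≠ j) (hik : i ≠ k)
    (hjk : j ≠ k) : bracket (g i) (g j) (g k) ≠ 0 := fun h => by
  obtain ⟨f, hf, hi, hj, hk⟩ := exists_functional_of_bracket_eq_zero h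
  exact hg.false_of_three hf hij hik hjk hi hj hk

lemma IsBalanced.exists_notMem (hg : IsBalanced d g) (s : Finset ι) (hs : s.card < 2 * d + 4) :
    ∃ i, i ∉ s := by
  by_contra! h
  have : s = Finset.univ := Finset.eq_univ_iff_forall.2 h
  rw [this, Finset.card_univ, hg.1] at hs
  omega

/-! ### Moving a functional -/

/-- A small move of a functional does not change its signs. -/
lemma exists_small_move (g : ι → Fin 3 → ℝ) (f h : (Fin 3 → ℝ) →ₗ[ℝ] ℝ) :
    ∃ t : ℝ, 0 < t ∧ ∀ i, (f (g i) < 0 → (f + t • h) (g i) < 0) ∧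
      (0 < f (g i) → 0 < (f + t • h) (g i)) := by
  have hc : ∀ i, Filter.Tendsto (fun t : ℝ => (f + t • h) (g i)) (nhdsWithin 0 (Ioi 0))
      (nhds (f (g i))) := fun i => by
    have : Continuous fun t : ℝ => (f + t • h) (g i) := by
      simp only [LinearMap.add_apply, LinearMap.smul_apply, smul_eq_mul]; fun_prop
    simpa using (this.tendsto 0).mono_left nhdsWithin_le_nhds
  have hev : ∀ᶠ t : ℝ in nhdsWithin 0 (Ioi 0), ∀ i, (f (g i) < 0 → (f + t • h) (g i) < 0) ∧
      (0 < f (g i) → 0 < (f + t • h) (g i)) := by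
    refine Filter.eventually_all.2 fun i => ?_
    rcases lt_trichotomy (f (g i)) 0 with hi | hi | hi
    · filter_upwards [(hc i).eventually_lt_const hi] with t ht
      exact ⟨fun _ => ht, fun h => absurd h hi.le.not_gt⟩
    · simp [hi]
    · filter_upwards [(hc i).eventually_const_lt hi] with t ht
      exact ⟨fun h => absurd h hi.le.not_gt, fun _ => ht⟩
  obtain ⟨t, ht, h0⟩ := (hev.and self_mem_nhdsWithin).exists
  exact ⟨t, h0, ht⟩

/-- A functional `f` moved in a direction `h` along which some value tends to zero reaches a first
position where one of its nonzero values vanishes. -/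
lemma exists_first_hit (g : ι → Fin 3 → ℝ) (f h : (Fin 3 → ℝ) →ₗ[ℝ] ℝ) {x : ι}
    (hx : f (g x) * h (g x) < 0) :
    ∃ t : ℝ, 0 < t ∧ (∃ y, f (g y) ≠ 0 ∧ (f + t • h) (g y) = 0) ∧
      ∀ i, (f (g i) < 0 → (f + t • h) (g i) ≤ 0) ∧ (0 < f (g i) → 0 ≤ (f + t • h) (g i)) := by
  classical
  obtain ⟨y, hy, hmin⟩ := Finset.exists_min_image
    (Finset.univ.filter fun i => f (g i) * h (g i) < 0) (fun i => -f (g i) / h (g i))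
    ⟨x, by simpa using hx⟩
  simp only [Finset.mem_filter, Finset.mem_univ, true_and] at hy hmin
  have hh : h (g y) ≠ 0 := fun h0 => by simp [h0] at hy
  have hf : f (g y) ≠ 0 := fun h0 => by simp [h0] at hy
  have ht : 0 < -f (g y) / h (g y) := by
    rcases lt_or_gt_of_ne hh with h1 | h1
    · have : 0 < f (g y) := by by_contra! h2; nlinarith
      exact div_pos_of_neg_of_neg (by linarith) h1
    · have : f (g y) < 0 := by by_contra! h2; nlinarith
      exact div_pos (by linarith) h1
  refine ⟨_, ht, ⟨y, hf, ?_⟩, fun i => ⟨fun hi => ?_, fun hi => ?_⟩⟩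
  · simp only [LinearMap.add_apply, LinearMap.smul_apply, smul_eq_mul]; field_simp; ring
  · simp only [LinearMap.add_apply, LinearMap.smul_apply, smul_eq_mul]
    rcases le_or_gt (h (g i)) 0 with h1 | h1
    · nlinarith
    · have := hmin i (by nlinarith)
      rw [le_div_iff₀ h1] at this
      linarith
  · simp only [LinearMap.add_apply, LinearMap.smul_apply, smul_eq_mul]
    rcases le_or_gt 0 (h (g i)) with h1 | h1
    · nlinarith
    · have := hmin i (by nlinarith)
      rw [le_div_iff_of_neg h1] at this
      linarith

lemma IsBalanced.exists_pos_of_card_le_one (hg : IsBalanced d g) {S : Finset ι} (hS : S.card ≤ 1)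
    {i : ι} (hi : i ∉ S) :
    ∃ h : (Fin 3 → ℝ) →ₗ[ℝ] ℝ, (∀ j ∈ S, h (g j) = 0) ∧ 0 < h (g i) := by
  classical
  obtain ⟨j, hj, hji⟩ : ∃ j, S ⊆ {j} ∧ j ≠ i := by
    rcases Finset.eq_empty_or_nonempty S with rfl | ⟨j, hj⟩
    · obtain ⟨j, hj⟩ := hg.exists_notMem {i} (by simp)
      exact ⟨j, by simp, by simpa using hj⟩
    · refine ⟨j, fun k hk => ?_, fun h => hi (h ▸ hj)⟩
      simp [Finset.card_le_one.1 hS k hk j hj]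
  obtain ⟨k, hk⟩ := hg.exists_notMem {i, j} (by
    have := Finset.card_le_two (a := i) (b := j); omega)
  simp only [Finset.mem_insert, Finset.mem_singleton, not_or] at hk
  have hb : bracket (g j) (g k) (g i) ≠ 0 := hg.bracket_ne_zero (Ne.symm hk.2) hji hk.1
  refine ⟨bracket (g j) (g k) (g i) • bracketL (g j) (g k), fun l hl => ?_, ?_⟩
  · have : l = j := by simpa using hj hl
    simp [this]
  · simpa using mul_self_pos.2 hb

/-- A functional can be moved slightly off one of the vectors on which it vanishes. -/
lemma IsBalanced.isCut_of_insert [DecidableEq ι] (hg : IsBalanced d g) {S A : Finset ι}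
    (hS : S.card ≤ 1) {i : ι} (hi : i ∉ S) (h : IsCut g (insert i S) A) : IsCut g S A := by
  obtain ⟨f, hf0, hfA, hf⟩ := h
  obtain ⟨h, hh0, hhi⟩ := hg.exists_pos_of_card_le_one hS hi
  obtain ⟨t, ht, hsign⟩ := exists_small_move g f h
  refine ⟨f + t • h, fun j hj => ?_, fun j hj => (hsign j).1 (hfA j hj), fun j hj hjA => ?_⟩
  · simp [hf0 j (Finset.mem_insert_of_mem hj), hh0 j hj]
  · by_cases hji : j = i
    · subst hji
      simpa [hf0 j (Finset.mem_insert_self _ _)] using mul_pos ht hhi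
    · exact (hsign j).2 (hf j (by simp [hji, hj]) hjA)

/-- If a functional vanishes on two vectors and is negative on `A`, it can be turned about one of
the two, `j`, so that it becomes negative on the other one, `i`, and positive on one member of `A`
instead. This is where the balance is used: the first vector hit cannot come from the positive
side. -/
lemma IsBalanced.exists_swap_of_isCut_pair [DecidableEq ι] (hg : IsBalanced d g) {i j : ι}
    (hij : i ≠ j) {A : Finset ι} (hA : A.card = d + 1) (h : IsCut g {i, j} A) :
    ∃ a ∈ A, IsCut g {j} (insert i (A.erase a)) := by
  obtain ⟨f, hf0, hfA, hf⟩ := h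
  obtain ⟨a, ha⟩ : A.Nonempty := Finset.card_pos.1 (by omega)
  have hfi : f (g i) = 0 := hf0 i (by simp)
  have hfj : f (g j) = 0 := hf0 j (by simp)
  have hiA : i ∉ A := fun h => (hfA i h).ne hfi
  have hjA : j ∉ A := fun h => (hfA j h).ne hfj
  have hb : bracket (g j) (g i) (g a) ≠ 0 :=
    hg.bracket_ne_zero hij.symm (fun h => hjA (h ▸ ha)) (fun h => hiA (h ▸ ha))
  obtain ⟨h, hhj, hhi, hha⟩ : ∃ h : (Fin 3 → ℝ) →ₗ[ℝ] ℝ, h (g j) = 0 ∧ h (g i) < 0 ∧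
      0 < h (g a) := by
    refine ⟨bracket (g j) (g i) (g a) • (bracketL (g j) (g a) + bracketL (g j) (g i)), by simp,
      ?_, ?_⟩
    · have := mul_self_pos.2 hb
      simp only [LinearMap.smul_apply, LinearMap.add_apply, bracketL_apply, bracket_self_right,
        bracket_swap_right (g j) (g i) (g a), smul_eq_mul]
      linarith
    · have := mul_self_pos.2 hb
      simpa using this
  obtain ⟨t, ht, ⟨y, hy, hyt⟩, hsign⟩ := exists_first_hit g f h (x := a)
    (mul_neg_of_neg_of_pos (hfA a ha) hha)
  set F := f + t • h with hF
  have hFj : F (g j) = 0 := by simp [hF, hfj, hhj]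
  have hFi : F (g i) < 0 := by simp [hF, hfi]; nlinarith
  have hF0 : F ≠ 0 := fun h0 => by simp [h0] at hFi
  have hyi : y ≠ i := fun h => hy (h ▸ hfi)
  have hyj : y ≠ j := fun h => hy (h ▸ hfj)
  have hzero : ∀ k, k ≠ j → k ≠ y → F (g k) ≠ 0 := fun k hkj hky h0 =>
    hg.false_of_three hF0 hkj hky hyj.symm h0 hFj hyt
  have hyA : y ∈ A := by
    by_contra hyA
    have hcard := hg.le_card_of_pos hF0 (s := ((Finset.univ \ A).erase i |>.erase j).erase y)
      fun k hk => by
        simp only [Finset.mem_erase, Finset.mem_sdiff, Finset.mem_univ, true_and]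
        refine ⟨fun h => ?_, fun h => ?_, fun h => ?_, fun h => ?_⟩
        · rw [h, hyt] at hk; exact lt_irrefl _ hk
        · rw [h, hFj] at hk; exact lt_irrefl _ hk
        · rw [h] at hk; exact hFi.not_gt hk
        · exact ((hsign k).1 (hfA k h)).not_gt hk
    rw [Finset.card_erase_of_mem (by simp [hyi, hyj, hyA]),
      Finset.card_erase_of_mem (by simp [hij.symm, hjA]), Finset.card_erase_of_mem (by simp [hiA]),
      Finset.card_sdiff_of_subset (Finset.subset_univ _), Finset.card_univ, hg.1, hA] at hcard
    omega
  refine ⟨y, hyA, hg.isCut_of_insert (S := {j}) (i := y) (by simp) (by simpa using hyj)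
    ⟨F, by simp [hyt, hFj], fun k hk => ?_, fun k hk hkA => ?_⟩⟩
  · rw [Finset.mem_insert, Finset.mem_erase] at hk
    rcases hk with rfl | ⟨hky, hk⟩
    · exact hFi
    · exact lt_of_le_of_ne ((hsign k).1 (hfA k hk)) (hzero k (fun h => hjA (h ▸ hk)) hky)
  · simp only [Finset.mem_insert, Finset.mem_singleton, not_or] at hk
    simp only [Finset.mem_insert, Finset.mem_erase, not_or, not_and] at hkA
    refine lt_of_le_of_ne ((hsign k).2 (hf k ?_ (hkA.2 hk.1))) (hzero k hk.2 hk.1).symm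
    simp [hkA.1, hk.2]

/-- A functional vanishing on one vector only can be turned about it until it vanishes on a second
one, taken from the larger side. -/
lemma IsBalanced.exists_isCut_pair [DecidableEq ι] (hg : IsBalanced d g) {i : ι}
    {A : Finset ι} (hA : A.card = d + 1) (h : IsCut g {i} A) : ∃ j, j ≠ i ∧ IsCut g {i, j} A := by
  obtain ⟨f, hf0, hfA, hf⟩ := h
  have hfi : f (g i) = 0 := hf0 i (by simp)
  obtain ⟨a, ha⟩ : A.Nonempty := Finset.card_pos.1 (by omega)
  have hiA : i ∉ A := fun h => (hfA i h).ne hfi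
  obtain ⟨u, hu⟩ := hg.exists_notMem (insert i A) (by
    rw [Finset.card_insert_of_notMem hiA]; omega)
  simp only [Finset.mem_insert, not_or] at hu
  have hb : bracket (g i) (g a) (g u) ≠ 0 :=
    hg.bracket_ne_zero (fun h => hiA (h ▸ ha)) (Ne.symm hu.1) (fun h => hu.2 (h ▸ ha))
  set h : (Fin 3 → ℝ) →ₗ[ℝ] ℝ := -(bracket (g i) (g a) (g u) • bracketL (g i) (g a)) with hh
  have hhu : h (g u) < 0 := by simpa [hh] using mul_self_pos.2 hb
  obtain ⟨t, ht, ⟨y, hy, hyt⟩, hsign⟩ := exists_first_hit g f h (x := u)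
    (mul_neg_of_pos_of_neg (hf u (by simpa using hu.1) hu.2) hhu)
  set F := f + t • h with hF
  have hFi : F (g i) = 0 := by simp [hF, hfi, hh]
  have hFa : F (g a) < 0 := by simpa [hF, hh] using hfA a ha
  have hF0 : F ≠ 0 := fun h0 => by simp [h0] at hFa
  have hyi : y ≠ i := fun h => hy (h ▸ hfi)
  have hzero : ∀ k, k ≠ i → k ≠ y → F (g k) ≠ 0 := fun k hki hky h0 =>
    hg.false_of_three hF0 hki hky hyi.symm h0 hFi hyt
  have hyA : y ∉ A := fun hyA => by
    have hcard := hg.le_card_of_neg hF0 (s := A.erase y) fun k hk => by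
      rw [Finset.mem_erase]
      refine ⟨fun h => by rw [h, hyt] at hk; exact lt_irrefl _ hk, ?_⟩
      by_contra hkA
      by_cases hki : k = i
      · rw [hki, hFi] at hk; exact lt_irrefl _ hk
      · exact ((hsign k).2 (hf k (by simpa using hki) hkA)).not_gt hk
    rw [Finset.card_erase_of_mem hyA, hA] at hcard
    omega
  refine ⟨y, hyi, F, by simp [hFi, hyt], fun k hk => ?_, fun k hk hkA => ?_⟩
  · exact lt_of_le_of_ne ((hsign k).1 (hfA k hk))
      (hzero k (fun h => hiA (h ▸ hk)) (fun h => hyA (h ▸ hk)))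
  · simp only [Finset.mem_insert, Finset.mem_singleton, not_or] at hk
    exact lt_of_le_of_ne ((hsign k).2 (hf k (by simpa using hk.1) hkA)) (hzero k hk.1 hk.2).symm

/-- The cuts through `S` and `i` can be read off from the cuts through `S`: those which remain cuts
after `i` is exchanged with some member of the negative side. -/
lemma IsBalanced.isCut_insert_iff [DecidableEq ι] (hg : IsBalanced d g) {S A : Finset ι}
    (hS : S.card ≤ 1) {i : ι} (hiS : i ∉ S) (hiA : i ∉ A) (hA : A.card = d + 1) :
    IsCut g (insert i S) A ↔ IsCut g S A ∧ ∃ a ∈ A, IsCut g S (insert i (A.erase a)) := by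
  constructor
  · intro h
    refine ⟨hg.isCut_of_insert hS hiS h, ?_⟩
    rcases Finset.eq_empty_or_nonempty S with rfl | ⟨j, hj⟩
    · obtain ⟨j, hji, hj⟩ := hg.exists_isCut_pair hA h
      obtain ⟨a, ha, hcut⟩ := hg.exists_swap_of_isCut_pair hji.symm hA hj
      exact ⟨a, ha, hg.isCut_of_insert (S := ∅) (i := j) (by simp) (by simp) hcut⟩
    · obtain rfl : S = {j} := by
        ext k; rw [Finset.mem_singleton]
        exact ⟨fun hk => Finset.card_le_one.1 hS k hk j hj, fun hk => hk ▸ hj⟩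
      exact hg.exists_swap_of_isCut_pair (by simpa using hiS) hA h
  · rintro ⟨⟨f, hf0, hfA, hf⟩, a, ha, h, hh0, hhA, hh⟩
    have hfi : 0 < f (g i) := hf i hiS hiA
    have hhi : h (g i) < 0 := hhA i (by simp)
    have hai : a ≠ i := fun h => hiA (h ▸ ha)
    -- the point of the segment from `f` to `h` that vanishes at `i`
    set F := (-h (g i)) • f + f (g i) • h with hF
    have hFi : F (g i) = 0 := by simp [hF]; ring
    have hpos : ∀ k, k ∉ S → k ∉ A → k ≠ i → 0 < F (g k) := fun k hkS hkA hki => by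
      have h1 := hf k hkS hkA
      have h2 := hh k hkS (by simp [hki, hkA])
      simp only [hF, LinearMap.add_apply, LinearMap.smul_apply, smul_eq_mul]
      nlinarith
    have hneg : ∀ k ∈ A, k ≠ a → F (g k) < 0 := fun k hk hka => by
      have h1 := hfA k hk
      have h2 := hhA k (by simp [hk, hka])
      simp only [hF, LinearMap.add_apply, LinearMap.smul_apply, smul_eq_mul]
      nlinarith
    have hFS : ∀ k ∈ S, F (g k) = 0 := fun k hk => by simp [hF, hf0 k hk, hh0 k hk]
    have hF0 : F ≠ 0 := fun h0 => by
      obtain ⟨k, hk⟩ := hg.exists_notMem (insert i (S ∪ A)) (by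
        have h1 := Finset.card_insert_le i (S ∪ A)
        have h2 := Finset.card_union_le S A
        omega)
      simp only [Finset.mem_insert, Finset.mem_union, not_or] at hk
      have := hpos k hk.2.1 hk.2.2 hk.1
      simp [h0] at this
    refine ⟨F, ?_, fun k hk => ?_, fun k hk hkA => ?_⟩
    · simpa [hFi] using hFS
    · by_cases hka : k = a
      · subst hka
        by_contra! hge
        have hcard := hg.le_card_of_neg hF0 (s := A.erase k) fun l hl => by
          rw [Finset.mem_erase]
          refine ⟨fun h => by rw [h] at hl; exact hge.not_gt hl, ?_⟩
          by_contra hlA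
          by_cases hlS : l ∈ S
          · exact hl.ne (hFS l hlS)
          · by_cases hli : l = i
            · exact hl.ne (hli ▸ hFi)
            · exact (hpos l hlS hlA hli).not_gt hl
        rw [Finset.card_erase_of_mem hk, hA] at hcard
        omega
      · exact hneg k hk hka
    · simp only [Finset.mem_insert, not_or] at hk
      exact hpos k hk.2 hkA hk.1

end Balanced

/-! ### Faces and positive dependences -/

section Faces

variable {ι : Type*} [Fintype ι]

/-- Some linear dependence between the vectors `g i` is zero on `M` and positive elsewhere. By Gale
duality these `M` are the vertex sets of faces. -/
def IsGaleFace {m : ℕ} (g : ι → Fin m → ℝ) (M : Set ι) : Prop :=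
  ∃ c : ι → ℝ, (∀ i, 0 ≤ c i) ∧ (∀ i, c i = 0 ↔ i ∈ M) ∧ ∑ i, c i • g i = 0

lemma isFaceVertexSet_iff_exists_affine {ι : Type*} {D : ℕ} {p : ι → Fin D → ℝ} {M : Set ι} :
    IsFaceVertexSet p M ↔ ∃ (a : (Fin D → ℝ) →ₗ[ℝ] ℝ) (b : ℝ),
      ∀ i, 0 ≤ a (p i) + b ∧ (a (p i) + b = 0 ↔ i ∈ M) := by
  have hmem : ∀ i, p i ∈ convexHull ℝ (range p) := fun i => subset_convexHull ℝ _ ⟨i, rfl⟩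
  constructor
  · rintro ⟨F, hF, rfl⟩
    rcases F.eq_empty_or_nonempty with rfl | hne
    · exact ⟨0, 1, by simp⟩
    · obtain ⟨l, hl⟩ := hF hne
      obtain ⟨x, hx⟩ := hne
      rw [hl] at hx
      refine ⟨-l, l x, fun i => ⟨by simpa using hx.2 _ (hmem i), ?_⟩⟩
      have hx' := hx.2 _ (hmem i)
      rw [mem_ofPred_eq, hl]
      constructor
      · intro h
        refine ⟨hmem i, fun y hy => (hx.2 y hy).trans ?_⟩
        simp at h
        linarith
      · rintro ⟨_, h⟩
        have := h x hx.1
        simp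
        linarith
  · rintro ⟨a, b, h⟩
    rcases M.eq_empty_or_nonempty with rfl | ⟨m, hm⟩
    · exact ⟨∅, fun h => absurd h not_nonempty_empty, by simp⟩
    · have hhull : ∀ y ∈ convexHull ℝ (range p), 0 ≤ a y + b := by
        have hc : Convex ℝ {y | -b ≤ a y} := convex_halfSpace_ge a.isLinear _
        have : convexHull ℝ (range p) ⊆ {y | -b ≤ a y} :=
          convexHull_min (by rintro _ ⟨i, rfl⟩; simpa using (by linarith [(h i).1])) hc
        intro y hy
        have := this hy
        simp at this
        linarith
      have hm0 := (h m).2.2 hm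
      refine ⟨{x ∈ convexHull ℝ (range p) | ∀ y ∈ convexHull ℝ (range p),
        (-LinearMap.toContinuousLinearMap a) y ≤ (-LinearMap.toContinuousLinearMap a) x},
        fun _ => ⟨_, rfl⟩, ?_⟩
      ext i
      simp only [mem_ofPred_eq, neg_apply,
        LinearMap.coe_toContinuousLinearMap', neg_le_neg_iff]
      constructor
      · intro hi
        refine ⟨hmem i, fun y hy => ?_⟩
        linarith [hhull y hy, (h i).2.2 hi]
      · rintro ⟨_, hi⟩
        exact (h i).2.1 (le_antisymm (by linarith [hi _ (hmem m)]) (h i).1)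

/-- Gale duality: values of affine functions on the configuration are exactly the linear dependences
of its Gale transform. -/
lemma isFaceVertexSet_iff_isGaleFace {D m : ℕ} {p : ι → Fin D → ℝ} {g : ι → Fin m → ℝ}
    (hg : IsGaleTransform p g) {M : Set ι} : IsFaceVertexSet p M ↔ IsGaleFace g M := by
  classical
  rw [isFaceVertexSet_iff_exists_affine]
  have hcoord : ∀ k, ∑ i, g i k = 0 ∧ ∑ i, g i k • p i = 0 := fun k =>
    (hg.2 fun i => g i k).1 (Submodule.subset_span ⟨k, rfl⟩)
  constructor
  · rintro ⟨a, b, h⟩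
    refine ⟨fun i => a (p i) + b, fun i => (h i).1, fun i => (h i).2, ?_⟩
    ext k
    have h1 : ∑ i, g i k * a (p i) = 0 := by
      simpa using congrArg a (hcoord k).2
    have h2 : ∑ i, b * g i k = 0 := by rw [← Finset.mul_sum, (hcoord k).1, mul_zero]
    simp only [Finset.sum_apply, Pi.smul_apply, smul_eq_mul, Pi.zero_apply, add_mul,
      Finset.sum_add_distrib, h2, add_zero]
    rw [← h1]
    exact Finset.sum_congr rfl fun i _ => mul_comm _ _
  · rintro ⟨c, hc0, hcM, hc⟩
    let T : (ι → ℝ) →ₗ[ℝ] (Fin D → ℝ) × ℝ :=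
      { toFun := fun x => (∑ i, x i • p i, ∑ i, x i)
        map_add' := fun x y => by
          simp [add_smul, Finset.sum_add_distrib]
        map_smul' := fun t x => by
          simp [Finset.smul_sum, mul_smul, Finset.mul_sum] }
    let L : (ι → ℝ) →ₗ[ℝ] ℝ :=
      { toFun := fun x => ∑ i, x i * c i
        map_add' := fun x y => by simp [add_mul, Finset.sum_add_distrib]
        map_smul' := fun t x => by simp [Finset.mul_sum, mul_assoc] }
    have hL : L ∈ LinearMap.range T.dualMap := by
      rw [LinearMap.range_dualMap_eq_dualAnnihilator_ker, Submodule.mem_dualAnnihilator]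
      intro x hx
      have hx' : x ∈ Submodule.span ℝ (range fun (k : Fin m) (i : ι) => g i k) := by
        rw [hg.2]
        have : T x = 0 := hx
        simp only [T, LinearMap.coe_mk, AddHom.coe_mk, Prod.mk_eq_zero] at this
        exact ⟨this.2, this.1⟩
      have hle : Submodule.span ℝ (range fun (k : Fin m) (i : ι) => g i k) ≤ LinearMap.ker L := by
        rw [Submodule.span_le]
        rintro _ ⟨k, rfl⟩
        have := congrFun hc k
        simp only [Finset.sum_apply, Pi.smul_apply, smul_eq_mul, Pi.zero_apply] at this
        simp only [SetLike.mem_coe, LinearMap.mem_ker, L, LinearMap.coe_mk, AddHom.coe_mk]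
        rw [← this]
        exact Finset.sum_congr rfl fun i _ => mul_comm _ _
      exact hle hx'
    obtain ⟨β, hβ⟩ := hL
    have hval : ∀ i, β.comp (LinearMap.inl ℝ _ _) (p i) + β (0, 1) = c i := fun i => by
      have := congrArg (fun f : (ι → ℝ) →ₗ[ℝ] ℝ => f (Pi.single i 1)) hβ
      simp only [LinearMap.dualMap_apply', LinearMap.comp_apply, T, L, LinearMap.coe_mk,
        AddHom.coe_mk] at this
      simp only [Pi.single_apply, ite_smul, one_smul, zero_smul, Finset.sum_ite_eq',
        Finset.mem_univ, if_true, ite_mul, one_mul, zero_mul] at this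
      rw [← this, LinearMap.comp_apply, ← map_add]
      simp
    exact ⟨_, _, fun i => by rw [hval]; exact ⟨hc0 i, hcM i⟩⟩

/-- A Gale transform of a neighbourly polytope is balanced. An affine dependence with at most `d`
positive coefficients is impossible: some face contains all its positive vertices and misses one of
the negative ones. -/
lemma isBalanced_of_isNeighborlyPolytope {d : ℕ} {p : ι → Fin (2 * d) → ℝ}
    (hp : IsNeighborlyPolytope d p) (hcard : Fintype.card ι = 2 * d + 4) {g : ι → Fin 3 → ℝ}
    (hg : IsGaleTransform p g) : IsBalanced d g := by
  classical
  refine ⟨hcard, fun f hf => ?_⟩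
  by_contra! hlt
  have hcomb : (fun i => f (g i)) = ∑ k, f (Pi.single k 1) • fun i => g i k := by
    ext i
    conv_lhs => rw [LinearMap.pi_apply_eq_sum_univ f (g i)]
    simp only [Finset.sum_apply, Pi.smul_apply, smul_eq_mul]
    exact Finset.sum_congr rfl fun k _ => by
      rw [mul_comm]; congr 2; ext j; simp [Pi.single_apply, eq_comm]
  have hdep := (hg.2 fun i => f (g i)).1 (by
    rw [hcomb]
    exact Submodule.sum_mem _ fun k _ => Submodule.smul_mem _ _ (Submodule.subset_span ⟨k, rfl⟩))
  have hne : ∃ i, f (g i) ≠ 0 := by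
    by_contra! h0
    apply hf
    have h1 := Fintype.linearIndependent_iff.1 hg.1 (fun k => f (Pi.single k 1))
      (by rw [← hcomb]; ext i; exact h0 i)
    refine LinearMap.pi_ext' fun k => LinearMap.ext_ring ?_
    simpa using h1 k
  obtain ⟨j, hj⟩ : ∃ j, f (g j) < 0 := by
    by_contra! h0
    obtain ⟨i, hi⟩ := hne
    exact hi ((Finset.sum_eq_zero_iff_of_nonneg fun i _ => h0 i).1 hdep.1 i (Finset.mem_univ i))
  obtain ⟨M, hM1, hM2, hM3⟩ := Finset.exists_subsuperset_card_eq
    (s := Finset.univ.filter fun i => 0 < f (g i)) (t := Finset.univ.erase j) (n := d)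
    (fun i hi => by
      simp only [Finset.mem_filter, Finset.mem_univ, true_and] at hi
      simp only [Finset.mem_erase, Finset.mem_univ, and_true]
      rintro rfl; exact hi.not_gt hj)
    (by omega) (by rw [Finset.card_erase_of_mem (Finset.mem_univ j), Finset.card_univ, hcard]; omega)
  obtain ⟨a, b, hab⟩ := isFaceVertexSet_iff_exists_affine.1 (hp.2 M hM3)
  have hsum : ∑ i, f (g i) * (a (p i) + b) = 0 := by
    have h1 : ∑ i, f (g i) * a (p i) = 0 := by simpa using congrArg a hdep.2
    simp only [mul_add, Finset.sum_add_distrib, h1, zero_add, ← Finset.sum_mul, hdep.1, zero_mul]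
  have hle : ∀ i, f (g i) * (a (p i) + b) ≤ 0 := fun i => by
    by_cases hi : i ∈ M
    · rw [(hab i).2.2 hi, mul_zero]
    · refine mul_nonpos_of_nonpos_of_nonneg ?_ (hab i).1
      by_contra! h
      exact hi (hM1 (by simpa using h))
  have hz := (Finset.sum_eq_zero_iff_of_nonpos fun i _ => hle i).1 hsum j (Finset.mem_univ j)
  rcases mul_eq_zero.1 hz with h | h
  · exact hj.ne h
  · have := hM2 ((hab j).2.1 h)
    simp at this

/-- A version of Stiemke's lemma: if no nonzero functional is nonnegative on the vectors with label
in `U`, then these have a linear dependence with positive coefficients. -/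
lemma exists_pos_dependence {g : ι → Fin 3 → ℝ} {U : Finset ι}
    (hU : ∀ f : (Fin 3 → ℝ) →ₗ[ℝ] ℝ, (∀ i ∈ U, 0 ≤ f (g i)) → f = 0) :
    ∃ c : ι → ℝ, (∀ i ∈ U, 0 < c i) ∧ (∀ i ∉ U, c i = 0) ∧ ∑ i, c i • g i = 0 := by
  classical
  let T : (U → ℝ) →ₗ[ℝ] (Fin 3 → ℝ) := Fintype.linearCombination ℝ fun i : U => g i
  have hT : ∀ x, T x = ∑ i, x i • g i := fun x => Fintype.linearCombination_apply ℝ _ x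
  have hsurj : Function.Surjective T := by
    rw [← LinearMap.range_eq_top]
    by_contra hne
    obtain ⟨f, hf, hle⟩ := Submodule.exists_le_ker_of_lt_top _ (lt_top_iff_ne_top.2 hne)
    refine hf (hU f fun i hi => ?_)
    have : T (Pi.single ⟨i, hi⟩ 1) ∈ LinearMap.ker f := hle ⟨_, rfl⟩
    rw [hT, Finset.sum_eq_single ⟨i, hi⟩ (by intro j _ hj; simp [hj]) (by simp)] at this
    simp at this
    exact this.ge
  let C : Set (U → ℝ) := {x | ∀ i, 0 < x i}
  have hC : IsOpen C := by
    have : C = ⋂ i, {x | 0 < x i} := by ext; simp [C]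
    rw [this]
    exact isOpen_iInter_of_finite fun i => isOpen_lt continuous_const (continuous_apply i)
  have hCc : Convex ℝ C := by
    intro x hx y hy s t hs ht hst i
    have h1 := hx i
    have h2 := hy i
    simp only [Pi.add_apply, Pi.smul_apply, smul_eq_mul]
    rcases hs.eq_or_lt with rfl | hs
    · have : t = 1 := by linarith
      simp [this, h2]
    · have := mul_pos hs h1
      have := mul_nonneg ht h2.le
      linarith
  have hopen : IsOpen (T '' C) :=
    (LinearMap.toContinuousLinearMap T).isOpenMap hsurj C hC
  by_cases h0 : (0 : Fin 3 → ℝ) ∈ T '' C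
  · obtain ⟨x, hx, hx0⟩ := h0
    refine ⟨fun i => if h : i ∈ U then x ⟨i, h⟩ else 0, fun i hi => by simpa [hi] using hx ⟨i, hi⟩,
      fun i hi => by simp [hi], ?_⟩
    rw [hT] at hx0
    rw [← hx0, ← Finset.sum_subset (Finset.subset_univ U) (fun i _ hi => by simp [hi]),
      ← Finset.sum_coe_sort U]
    exact Finset.sum_congr rfl fun i _ => by simp
  · obtain ⟨f, hf⟩ := geometric_hahn_banach_open_point (hCc.linear_image T) hopen h0
    have hneg : ∀ x ∈ C, f (T x) < 0 := fun x hx => by simpa using hf _ ⟨x, hx, rfl⟩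
    have h1 : (-f).toLinearMap = 0 := by
      refine hU _ fun i hi => ?_
      by_contra! h
      have hfi : 0 < f (g i) := by simpa using h
      -- a large coefficient at `i` makes the value positive
      set x : U → ℝ := fun _ => 1
      have hx := hneg x fun _ => one_pos
      have hy := hneg (x + Pi.single ⟨i, hi⟩ (-f (T x) / f (g i))) fun j => by
        have : 0 ≤ (Pi.single ⟨i, hi⟩ (-f (T x) / f (g i)) : U → ℝ) j := by
          rw [Pi.single_apply]
          split_ifs
          · exact div_nonneg (by linarith) hfi.le
          · exact le_rfl
        simp only [Pi.add_apply, x]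
        linarith
      have hs : T (Pi.single ⟨i, hi⟩ (-f (T x) / f (g i))) = (-f (T x) / f (g i)) • g i := by
        rw [hT, Finset.sum_eq_single ⟨i, hi⟩ (by intro j _ hj; simp [hj]) (by simp)]
        simp
      rw [map_add, map_add, hs, map_smul, smul_eq_mul, div_mul_cancel₀ _ hfi.ne'] at hy
      linarith
    have := hneg (fun _ => 1) fun _ => one_pos
    have h2 : (-f).toLinearMap (T fun _ => 1) = 0 := by rw [h1]; rfl
    simp at h2
    linarith

variable {d : ℕ} {g : ι → Fin 3 → ℝ}

/-- The missing faces with `d + 1` vertices of the polytope are the cuts. -/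
lemma IsBalanced.isCut_empty_iff (hg : IsBalanced d g) {A : Finset ι} (hA : A.card = d + 1) :
    IsCut g ∅ A ↔ ¬ IsGaleFace g (A : Set ι) := by
  classical
  constructor
  · rintro ⟨f, -, -, hf⟩ ⟨c, hc0, hcA, hc⟩
    have hsum : ∑ i, c i * f (g i) = 0 := by simpa using congrArg f hc
    have hnn : ∀ i, 0 ≤ c i * f (g i) := fun i => by
      by_cases hi : i ∈ A
      · rw [(hcA i).2 (by simpa using hi), zero_mul]
      · exact mul_nonneg (hc0 i) (hf i (by simp) hi).le
    obtain ⟨i, hi⟩ := hg.exists_notMem A (by omega)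
    have := (Finset.sum_eq_zero_iff_of_nonneg fun i _ => hnn i).1 hsum i (Finset.mem_univ i)
    rcases mul_eq_zero.1 this with h | h
    · exact hi (by simpa using (hcA i).1 h)
    · exact (hf i (by simp) hi).ne' h
  · intro hnot
    by_contra hcut
    obtain ⟨c, hc1, hc2, hc3⟩ := exists_pos_dependence (g := g) (U := Finset.univ \ A) fun f hf => by
      by_contra hf0
      have hf' : ∀ i ∉ A, 0 ≤ f (g i) := fun i hi => hf i (by simpa using hi)
      have hneg : ∀ i ∈ A, f (g i) < 0 := fun i hi => by
        by_contra! hge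
        have := hg.le_card_of_neg hf0 (s := A.erase i) fun k hk => by
          rw [Finset.mem_erase]
          refine ⟨fun h => by rw [h] at hk; exact hge.not_gt hk, ?_⟩
          by_contra hkA
          exact (hf' k hkA).not_gt hk
        rw [Finset.card_erase_of_mem hi] at this
        omega
      -- `f` is moved off the zeros one at a time
      have key : ∀ (n : ℕ) (S : Finset ι), S.card = n → n ≤ 2 → ¬ IsCut g S A := by
        intro n
        induction n with
        | zero =>
          intro S hS _ h
          rw [Finset.card_eq_zero.1 hS] at h
          exact hcut h
        | succ n ih =>
          intro S hS hn h
          obtain ⟨i, S', hi, rfl, hS'⟩ := Finset.card_eq_succ.1 hS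
          exact ih S' hS' (by omega) (hg.isCut_of_insert (by omega) hi h)
      refine key _ (Finset.univ.filter fun i => f (g i) = 0) rfl (hg.card_le_two hf0 (by simp))
        ⟨f, by simp, hneg, fun i hi hiA => ?_⟩
      exact lt_of_le_of_ne (hf' i hiA) (by simpa [eq_comm] using hi)
    refine hnot ⟨c, fun i => ?_, fun i => ?_, hc3⟩
    · by_cases hi : i ∈ A
      · exact (hc2 i (by simpa using hi)).ge
      · exact (hc1 i (by simpa using hi)).le
    · by_cases hi : i ∈ A
      · simp [hi, hc2 i (by simpa using hi)]
      · simpa [hi] using (hc1 i (by simpa using hi)).ne'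

/-- Four vectors with a linear dependence all coefficients of which are positive. -/
def IsCofacet (g : ι → Fin 3 → ℝ) (i j k l : ι) : Prop :=
  ∃ a b c e : ℝ, 0 < a ∧ 0 < b ∧ 0 < c ∧ 0 < e ∧
    a • g i + b • g j + c • g k + e • g l = 0

lemma IsCofacet.swap12 {ι : Type*} {g : ι → Fin 3 → ℝ} {i j k l : ι}
    (h : IsCofacet g i j k l) : IsCofacet g j i k l := by
  obtain ⟨a, b, c, e, ha, hb, hc, he, h⟩ := h
  exact ⟨b, a, c, e, hb, ha, hc, he, by rw [← h]; abel⟩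

lemma IsCofacet.swap23 {ι : Type*} {g : ι → Fin 3 → ℝ} {i j k l : ι}
    (h : IsCofacet g i j k l) : IsCofacet g i k j l := by
  obtain ⟨a, b, c, e, ha, hb, hc, he, h⟩ := h
  exact ⟨a, c, b, e, ha, hc, hb, he, by rw [← h]; abel⟩

lemma IsCofacet.swap34 {ι : Type*} {g : ι → Fin 3 → ℝ} {i j k l : ι}
    (h : IsCofacet g i j k l) : IsCofacet g i j l k := by
  obtain ⟨a, b, c, e, ha, hb, hc, he, h⟩ := h
  exact ⟨a, b, e, c, ha, hb, he, hc, by rw [← h]; abel⟩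

lemma IsCofacet.exists_dependence {i j k l : ι} (h : IsCofacet g i j k l) :
    ∃ c : ι → ℝ, (∀ x, 0 ≤ c x) ∧ 0 < c i ∧ (∀ x, x ≠ i → x ≠ j → x ≠ k → x ≠ l → c x = 0) ∧
      ∑ x, c x • g x = 0 := by
  classical
  obtain ⟨a, b, c, e, ha, hb, hc, he, h⟩ := h
  refine ⟨Pi.single i a + Pi.single j b + Pi.single k c + Pi.single l e, fun x => ?_, ?_,
    fun x h1 h2 h3 h4 => by simp [h1, h2, h3, h4], ?_⟩
  · simp only [Pi.add_apply, Pi.single_apply]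
    split_ifs <;> positivity
  · simp only [Pi.add_apply, Pi.single_apply]
    split_ifs <;> positivity
  · simpa [Pi.single_apply, add_smul, Finset.sum_add_distrib, ite_smul] using h

/-- Carathéodory's theorem for cones: a nonnegative dependence that involves `u` contains one of
four vectors that involves `u`. -/
lemma IsBalanced.exists_isCofacet (hg : IsBalanced d g) {u : ι} (c : ι → ℝ) (hc0 : ∀ i, 0 ≤ c i)
    (hcu : 0 < c u) (hc : ∑ i, c i • g i = 0) :
    ∃ i j k, (u ≠ i ∧ u ≠ j ∧ u ≠ k ∧ i ≠ j ∧ i ≠ k ∧ j ≠ k) ∧ 0 < c i ∧ 0 < c j ∧ 0 < c k ∧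
      IsCofacet g u i j k := by
  classical
  induction h : (Finset.univ.filter fun i => 0 < c i).card using Nat.strong_induction_on
    generalizing c with
  | _ n ih =>
  set s := Finset.univ.filter fun i => 0 < c i with hs
  have hmem : ∀ i, i ∈ s ↔ 0 < c i := by simp [hs]
  have hus : u ∈ s := (hmem u).2 hcu
  have hsum : ∑ i ∈ s, c i • g i = 0 := by
    rw [← hc]
    refine Finset.sum_subset (Finset.subset_univ s) fun i _ hi => ?_
    rw [le_antisymm (not_lt.1 fun h => hi ((hmem i).2 h)) (hc0 i), zero_smul]
  have hcard : (s.erase u).card = n - 1 := by rw [Finset.card_erase_of_mem hus, h]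
  rcases lt_trichotomy n 4 with hn | hn | hn
  · exfalso
    obtain ⟨t, ht1, ht2, ht3⟩ := Finset.exists_subsuperset_card_eq (s := s.erase u)
      (t := Finset.univ.erase u) (n := 2) (Finset.erase_subset_erase _ (Finset.subset_univ _))
      (by omega) (by rw [Finset.card_erase_of_mem (Finset.mem_univ u), Finset.card_univ, hg.1]; omega)
    have hut : u ∉ t := fun h => by simpa using ht2 h
    obtain ⟨x, y, hxy, rfl⟩ := Finset.card_eq_two.1 ht3
    simp only [Finset.mem_insert, Finset.mem_singleton, not_or] at hut
    have h1 := congrArg (bracketL (g x) (g y)) hsum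
    rw [map_sum, map_zero, Finset.sum_eq_single u] at h1
    · simp only [map_smul, bracketL_apply, smul_eq_mul, mul_eq_zero] at h1
      rcases h1 with h1 | h1
      · exact hcu.ne' h1
      · exact hg.bracket_ne_zero hxy (Ne.symm hut.1) (Ne.symm hut.2) h1
    · intro b hb hbu
      have := ht1 (Finset.mem_erase.2 ⟨hbu, hb⟩)
      simp only [Finset.mem_insert, Finset.mem_singleton] at this
      rcases this with rfl | rfl <;> simp
    · exact fun h => absurd hus h
  · obtain ⟨i, j, k, hij, hik, hjk, hijk⟩ := Finset.card_eq_three.1 (hcard.trans (by omega))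
    have h' : ∀ x, x = i ∨ x = j ∨ x = k → x ∈ s.erase u := fun x hx => by simpa [hijk] using hx
    have hi := Finset.mem_erase.1 (h' i (by simp))
    have hj := Finset.mem_erase.1 (h' j (by simp))
    have hk := Finset.mem_erase.1 (h' k (by simp))
    refine ⟨i, j, k, ⟨hi.1.symm, hj.1.symm, hk.1.symm, hij, hik, hjk⟩, (hmem i).1 hi.2,
      (hmem j).1 hj.2, (hmem k).1 hk.2, c u, c i, c j, c k, hcu, (hmem i).1 hi.2,
      (hmem j).1 hj.2, (hmem k).1 hk.2, ?_⟩
    rw [← Finset.insert_erase hus, hijk, Finset.sum_insert, Finset.sum_insert, Finset.sum_insert,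
      Finset.sum_singleton] at hsum
    · rw [← hsum]; abel
    · simpa using hjk
    · simpa using ⟨hij, hik⟩
    · simpa using ⟨hi.1.symm, hj.1.symm, hk.1.symm⟩
  · -- subtract a multiple of a dependence between four vectors other than `u`
    obtain ⟨t, hts, ht⟩ := Finset.exists_subset_card_eq (s := s.erase u) (n := 4) (by omega)
    obtain ⟨w, hw0, hwt, ⟨y, hy⟩⟩ : ∃ w : ι → ℝ, ∑ i, w i • g i = 0 ∧ (∀ i ∉ t, w i = 0) ∧
        ∃ y, 0 < w y := by
      obtain ⟨x₁, t', hx₁, rfl, ht'⟩ := Finset.card_eq_succ.1 ht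
      obtain ⟨x₂, x₃, x₄, h23, h24, h34, rfl⟩ := Finset.card_eq_three.1 ht'
      simp only [Finset.mem_insert, Finset.mem_singleton, not_or] at hx₁
      set w : ι → ℝ := Pi.single x₁ (bracket (g x₂) (g x₃) (g x₄)) +
        Pi.single x₂ (-bracket (g x₁) (g x₃) (g x₄)) + Pi.single x₃ (bracket (g x₁) (g x₂) (g x₄)) +
        Pi.single x₄ (-bracket (g x₁) (g x₂) (g x₃)) with hw
      have hw0 : ∑ i, w i • g i = 0 := by
        rw [← cramer (g x₁) (g x₂) (g x₃) (g x₄)]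
        simp [hw, Pi.single_apply, add_smul, Finset.sum_add_distrib, ite_smul, sub_eq_add_neg]
      have hwt : ∀ i ∉ ({x₁, x₂, x₃, x₄} : Finset ι), w i = 0 := fun i hi => by
        simp only [Finset.mem_insert, Finset.mem_singleton, not_or] at hi
        simp [hw, hi]
      have hw1 : w x₁ ≠ 0 := by
        have := hg.bracket_ne_zero h23 h24 h34
        simpa [hw, Pi.single_apply, hx₁] using this
      rcases lt_or_gt_of_ne hw1 with h1 | h1
      · exact ⟨-w, by simpa [Finset.sum_neg_distrib] using hw0, fun i hi => by simp [hwt i hi],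
          x₁, by simpa using h1⟩
      · exact ⟨w, hw0, hwt, x₁, h1⟩
    obtain ⟨z, hz, hmin⟩ := Finset.exists_min_image (Finset.univ.filter fun i => 0 < w i)
      (fun i => c i / w i) ⟨y, by simpa using hy⟩
    simp only [Finset.mem_filter, Finset.mem_univ, true_and] at hz hmin
    have htz : z ∈ s ∧ z ≠ u := by
      have : z ∈ t := by by_contra h; exact hz.ne' (hwt z h)
      exact ⟨(Finset.mem_erase.1 (hts this)).2, (Finset.mem_erase.1 (hts this)).1⟩
    have hr : 0 ≤ c z / w z := div_nonneg (hc0 z) hz.le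
    set c' : ι → ℝ := fun i => c i - c z / w z * w i with hc'
    have hwu : w u = 0 := hwt u fun h => by simpa using hts h
    have hsub : ∀ i, 0 < c' i → 0 < c i := fun i hi => by
      by_contra hci
      have hits : i ∉ t := fun h => hci ((hmem i).1 (Finset.mem_erase.1 (hts h)).2)
      rw [hc'] at hi
      simp only [hwt i hits, mul_zero, sub_zero] at hi
      exact hci hi
    have hlt : (Finset.univ.filter fun i => 0 < c' i).card < n := by
      rw [← h]
      refine Finset.card_lt_card ((Finset.ssubset_iff_of_subset fun i hi => ?_).2 ⟨z, htz.1, ?_⟩)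
      · rw [hmem]; exact hsub i (by simpa using hi)
      · have : c' z = 0 := by simp only [hc']; field_simp; ring
        simp [this]
    obtain ⟨i, j, k, hne, hi, hj, hk, hcof⟩ := ih _ hlt c' (fun i => by
        simp only [hc']
        rcases le_or_gt (w i) 0 with h1 | h1
        · nlinarith [hc0 i]
        · have := hmin i h1
          rw [le_div_iff₀ h1] at this
          linarith) (by simpa [hc', hwu] using hcu) (by
        simp only [hc', sub_smul, mul_smul, Finset.sum_sub_distrib, ← Finset.smul_sum, hw0, hc,
          smul_zero, sub_zero]) rfl
    exact ⟨i, j, k, hne, hsub i hi, hsub j hj, hsub k hk, hcof⟩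

/-- The complements of the vertex sets of faces are the unions of cofacets. -/
lemma IsBalanced.isGaleFace_iff (hg : IsBalanced d g) {M : Set ι} :
    IsGaleFace g M ↔ ∀ u ∉ M, ∃ i j k, (u ≠ i ∧ u ≠ j ∧ u ≠ k ∧ i ≠ j ∧ i ≠ k ∧ j ≠ k) ∧
      i ∉ M ∧ j ∉ M ∧ k ∉ M ∧ IsCofacet g u i j k := by
  classical
  constructor
  · rintro ⟨c, hc0, hcM, hc⟩ u hu
    have hpos : ∀ i, 0 < c i → i ∉ M := fun i hi h => hi.ne' ((hcM i).2 h)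
    obtain ⟨i, j, k, hne, hi, hj, hk, h⟩ := hg.exists_isCofacet c hc0
      (lt_of_le_of_ne (hc0 u) fun h => hu ((hcM u).1 h.symm)) hc
    exact ⟨i, j, k, hne, hpos i hi, hpos j hj, hpos k hk, h⟩
  · intro h
    have h' : ∀ u, ∃ c : ι → ℝ, (∀ x, 0 ≤ c x) ∧ (u ∉ M → 0 < c u) ∧ (∀ x ∈ M, c x = 0) ∧
        ∑ x, c x • g x = 0 := fun u => by
      by_cases hu : u ∈ M
      · exact ⟨0, by simp, fun h => absurd hu h, by simp, by simp⟩
      · obtain ⟨i, j, k, -, hi, hj, hk, hcof⟩ := h u hu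
        obtain ⟨c, hc0, hcu, hcz, hc⟩ := hcof.exists_dependence
        exact ⟨c, hc0, fun _ => hcu, fun x hx => hcz x (fun h => hu (h ▸ hx)) (fun h => hi (h ▸ hx))
          (fun h => hj (h ▸ hx)) (fun h => hk (h ▸ hx)), hc⟩
    choose c hc0 hcu hcM hc using h'
    refine ⟨fun x => ∑ u, c u x, fun x => Finset.sum_nonneg fun u _ => hc0 u x, fun x => ?_, ?_⟩
    · constructor
      · intro h0
        by_contra hx
        have := (Finset.sum_eq_zero_iff_of_nonneg fun u _ => hc0 u x).1 h0 x (Finset.mem_univ x)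
        exact (hcu x hx).ne' this
      · exact fun hx => Finset.sum_eq_zero fun u _ => hcM u x hx
    · simp only [Finset.sum_smul]
      rw [Finset.sum_comm]
      exact Finset.sum_eq_zero fun u _ => hc u

end Faces

/-! ### Rigidity -/

section Rigidity

variable {ι κ : Type*} [Fintype ι] [Fintype κ] {d : ℕ} {g : ι → Fin 3 → ℝ} {g' : κ → Fin 3 → ℝ}

/-- A bijection that respects the cuts through no vector respects the cuts through at most two
vectors. -/
lemma isCut_map_iff (hg : IsBalanced d g) (hg' : IsBalanced d g') {σ : ι ≃ κ}
    (h0 : ∀ A : Finset ι, A.card = d + 1 → (IsCut g ∅ A ↔ IsCut g' ∅ (A.map σ.toEmbedding)))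
    (S : Finset ι) (hS : S.card ≤ 2) (A : Finset ι) (hA : A.card = d + 1) :
    IsCut g S A ↔ IsCut g' (S.map σ.toEmbedding) (A.map σ.toEmbedding) := by
  classical
  induction S using Finset.induction_on generalizing A with
  | empty => simpa using h0 A hA
  | insert i S hi ih =>
    rw [Finset.card_insert_of_notMem hi] at hS
    rw [Finset.map_insert]
    by_cases hiA : i ∈ A
    · refine iff_of_false ?_ ?_
      · rintro ⟨f, hf0, hfA, -⟩
        exact (hfA i hiA).ne (hf0 i (by simp))
      · rintro ⟨f, hf0, hfA, -⟩
        exact (hfA (σ i) (by simpa using hiA)).ne (hf0 (σ i) (by simp))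
    · rw [hg.isCut_insert_iff (by omega) hi hiA hA, hg'.isCut_insert_iff (by simpa using hS)
        (by simpa using hi) (by simpa using hiA) (by simpa using hA), ih (by omega) A hA]
      refine and_congr_right fun _ => ?_
      simp only [Finset.mem_map, exists_exists_and_eq_and]
      refine exists_congr fun a => and_congr_right fun ha => ?_
      have hcard : (insert i (A.erase a)).card = d + 1 := by
        rw [Finset.card_insert_of_notMem (fun h => hiA (Finset.mem_of_mem_erase h)),
          Finset.card_erase_of_mem ha, hA]
        omega
      rw [ih (by omega) _ hcard, Finset.map_insert, Finset.map_erase]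

/-- Bijections that respect cuts respect the sides of each plane spanned by two of the vectors. -/
lemma exists_sign_bracket_pair (hg : IsBalanced d g) (hg' : IsBalanced d g') {σ : ι ≃ κ}
    (h2 : ∀ S : Finset ι, S.card ≤ 2 → ∀ A : Finset ι, A.card = d + 1 →
      (IsCut g S A ↔ IsCut g' (S.map σ.toEmbedding) (A.map σ.toEmbedding)))
    {i j : ι} (hij : i ≠ j) :
    ∃ s : SignType, s ≠ 0 ∧ ∀ k, SignType.sign (bracket (g' (σ i)) (g' (σ j)) (g' (σ k))) =
      s * SignType.sign (bracket (g i) (g j) (g k)) := by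
  classical
  set f := bracketL (g i) (g j) with hf
  obtain ⟨k₀, hk₀⟩ := hg.exists_notMem {i, j} (by
    have := Finset.card_le_two (a := i) (b := j); omega)
  simp only [Finset.mem_insert, Finset.mem_singleton, not_or] at hk₀
  have hfk : ∀ k, k ≠ i → k ≠ j → f (g k) ≠ 0 := fun k hi hj =>
    hg.bracket_ne_zero hij (Ne.symm hi) (Ne.symm hj)
  have hf0 : f ≠ 0 := fun h => hfk k₀ hk₀.1 hk₀.2 (by rw [h]; rfl)
  have hfi : f (g i) = 0 := by simp [hf]
  have hfj : f (g j) = 0 := by simp [hf]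
  set A := Finset.univ.filter fun k => f (g k) < 0 with hA
  have hAcard : A.card = d + 1 := by
    refine le_antisymm ?_ (hg.le_card_of_neg hf0 (by simp [hA]))
    have h1 := hg.le_card_of_pos hf0 (s := Finset.univ \ (insert i (insert j A))) fun k hk => by
      simp only [Finset.mem_sdiff, Finset.mem_univ, true_and, Finset.mem_insert, not_or]
      refine ⟨fun h => ?_, fun h => ?_, fun h => ?_⟩
      · rw [h, hfi] at hk; exact lt_irrefl _ hk
      · rw [h, hfj] at hk; exact lt_irrefl _ hk
      · exact hk.not_gt (by simpa [hA] using h)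
    rw [Finset.card_sdiff_of_subset (Finset.subset_univ _), Finset.card_univ, hg.1,
      Finset.card_insert_of_notMem, Finset.card_insert_of_notMem] at h1
    · omega
    · simp [hA, hfj]
    · simp [hA, hfi, hij]
  have hcut : IsCut g {i, j} A := ⟨f, by simp [hfi, hfj], by simp [hA], fun k hk hkA => by
    simp only [Finset.mem_insert, Finset.mem_singleton, not_or] at hk
    exact lt_of_le_of_ne (by simpa [hA] using hkA) (hfk k hk.1 hk.2).symm⟩
  obtain ⟨f', hf'0, hf'A, hf'⟩ := (h2 _ (Finset.card_le_two) A hAcard).1 hcut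
  have hf'i : f' (g' (σ i)) = 0 := hf'0 _ (by simp)
  have hf'j : f' (g' (σ j)) = 0 := hf'0 _ (by simp)
  have hsign : ∀ k, SignType.sign (f' (g' (σ k))) = SignType.sign (f (g k)) := fun k => by
    by_cases hki : k = i
    · rw [hki, hf'i, hfi]
    by_cases hkj : k = j
    · rw [hkj, hf'j, hfj]
    rcases lt_or_gt_of_ne (hfk k hki hkj) with h | h
    · rw [sign_neg h, sign_neg (hf'A _ (by simpa [hA] using h))]
    · rw [sign_pos h, sign_pos (hf' _ (by simp [hki, hkj]) (by simpa [hA] using h.le))]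
  have hb : bracket (g' (σ i)) (g' (σ j)) (g' (σ k₀)) ≠ 0 :=
    hg'.bracket_ne_zero (by simpa using hij) (by simpa using Ne.symm hk₀.1)
      (by simpa using Ne.symm hk₀.2)
  have hs0 : SignType.sign (f (g k₀)) * SignType.sign (f (g k₀)) = 1 := by
    rw [← sign_mul, sign_pos (mul_self_pos.2 (hfk k₀ hk₀.1 hk₀.2))]
  refine ⟨SignType.sign (bracket (g' (σ i)) (g' (σ j)) (g' (σ k₀))) * SignType.sign (f (g k₀)),
    mul_ne_zero (sign_ne_zero.2 hb) (sign_ne_zero.2 (hfk k₀ hk₀.1 hk₀.2)), fun k => ?_⟩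
  -- both functionals vanish on the same plane, so they are proportional
  have hprop := cramer_apply f' (g' (σ i)) (g' (σ j)) (g' (σ k)) (g' (σ k₀))
  rw [hf'i, hf'j] at hprop
  have hprop' : bracket (g' (σ i)) (g' (σ j)) (g' (σ k)) * f' (g' (σ k₀)) =
    bracket (g' (σ i)) (g' (σ j)) (g' (σ k₀)) * f' (g' (σ k)) := by linarith
  have := congrArg SignType.sign hprop'
  rw [sign_mul, sign_mul, hsign, hsign] at this
  calc _ = SignType.sign (bracket (g' (σ i)) (g' (σ j)) (g' (σ k))) *
        (SignType.sign (f (g k₀)) * SignType.sign (f (g k₀))) := by rw [hs0, mul_one]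
    _ = _ := by rw [← mul_assoc, this]; simp only [hf, bracketL_apply]; ac_rfl

/-- The oriented matroid of a balanced configuration is determined, up to a global change of
orientation, by its cuts through no vector, that is, by the missing faces of the polytope. -/
lemma exists_sign_bracket (hg : IsBalanced d g) (hg' : IsBalanced d g') {σ : ι ≃ κ}
    (h0 : ∀ A : Finset ι, A.card = d + 1 → (IsCut g ∅ A ↔ IsCut g' ∅ (A.map σ.toEmbedding))) :
    ∃ s : SignType, s ≠ 0 ∧ ∀ i j k, SignType.sign (bracket (g' (σ i)) (g' (σ j)) (g' (σ k))) =
      s * SignType.sign (bracket (g i) (g j) (g k)) := by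
  classical
  have hpair : ∀ i j : ι, ∃ s : SignType, s ≠ 0 ∧ (i ≠ j → ∀ k,
      SignType.sign (bracket (g' (σ i)) (g' (σ j)) (g' (σ k))) =
        s * SignType.sign (bracket (g i) (g j) (g k))) := fun i j => by
    by_cases hij : i = j
    · exact ⟨1, by decide, fun h => absurd hij h⟩
    · obtain ⟨s, hs, h⟩ := exists_sign_bracket_pair hg hg' (isCut_map_iff hg hg' h0) hij
      exact ⟨s, hs, fun _ => h⟩
  choose ε hε0 hε using hpair
  have hcancel : ∀ {i j k : ι}, i ≠ j → i ≠ k → j ≠ k → ∀ s t : SignType,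
      s * SignType.sign (bracket (g i) (g j) (g k)) =
        t * SignType.sign (bracket (g i) (g j) (g k)) → s = t := fun hij hik hjk s t h =>
    mul_right_cancel₀ (sign_ne_zero.2 (hg.bracket_ne_zero hij hik hjk)) h
  have hthird : ∀ i j : ι, ∃ k, i ≠ k ∧ j ≠ k := fun i j => by
    obtain ⟨k, hk⟩ := hg.exists_notMem {i, j} (by
      have := Finset.card_le_two (a := i) (b := j); omega)
    simp only [Finset.mem_insert, Finset.mem_singleton, not_or] at hk
    exact ⟨k, Ne.symm hk.1, Ne.symm hk.2⟩
  have hsymm : ∀ i j, i ≠ j → ε i j = ε j i := fun i j hij => by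
    obtain ⟨k, hik, hjk⟩ := hthird i j
    refine hcancel hij hik hjk _ _ ?_
    rw [← hε i j hij k]
    have := hε j i hij.symm k
    rw [bracket_swap, bracket_swap (g i), Left.sign_neg, Left.sign_neg, mul_neg] at this
    exact neg_injective this
  have hright : ∀ i j k, i ≠ j → i ≠ k → ε i j = ε i k := fun i j k hij hik => by
    by_cases hjk : j = k
    · rw [hjk]
    refine hcancel hij hik hjk _ _ ?_
    rw [← hε i j hij k]
    have := hε i k hik j
    rw [bracket_swap_right, bracket_swap_right (g i), Left.sign_neg, Left.sign_neg, mul_neg] at this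
    exact neg_injective this
  obtain ⟨o, -⟩ := hg.exists_notMem ∅ (by simp)
  obtain ⟨o', hoo', -⟩ := hthird o o
  refine ⟨ε o o', hε0 _ _, fun i j k => ?_⟩
  by_cases hij : i = j
  · simp [hij]
  have : ε i j = ε o o' := by
    by_cases hio : i = o
    · subst hio; exact hright _ _ _ hij hoo'
    · rw [hright i j o hij hio, hsymm i o hio]
      exact hright _ _ _ (Ne.symm hio) hoo'
  rw [hε i j hij k, this]

end Rigidity

/-! ### Configurations coming from T-diagrams -/

section TConfig

variable {ι : Type*} [Fintype ι]

/-- A balanced configuration together with the set `W` of labels of the white points of a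
T-diagram. That the black points are in convex position is expressed by supporting functionals:
for each black `u` some functional vanishes at `u`, is positive on the other black vectors and
negative on the white ones. -/
structure IsTConfig (d : ℕ) (g : ι → Fin 3 → ℝ) (W : Finset ι) : Prop where
  balanced : IsBalanced d g
  card : W.card = d + 1
  cut : ∀ u ∉ W, IsCut g {u} W

variable {d : ℕ} {g : ι → Fin 3 → ℝ} {W : Finset ι}

lemma IsTConfig.exists_support (h : IsTConfig d g W) {u : ι} (hu : u ∉ W) :
    ∃ f : (Fin 3 → ℝ) →ₗ[ℝ] ℝ, f (g u) = 0 ∧ (∀ i ∈ W, f (g i) < 0) ∧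
      ∀ i ∉ W, i ≠ u → 0 < f (g i) := by
  obtain ⟨f, hf0, hfW, hf⟩ := h.cut u hu
  exact ⟨f, hf0 u (by simp), hfW, fun i hi hiu => hf i (by simpa using hiu) hi⟩

lemma IsTConfig.exists_notMem (h : IsTConfig d g W) : ∃ u, u ∉ W :=
  h.balanced.exists_notMem W (by rw [h.card]; omega)

lemma IsTConfig.exists_level (h : IsTConfig d g W) :
    ∃ f : (Fin 3 → ℝ) →ₗ[ℝ] ℝ, (∀ i ∈ W, f (g i) < 0) ∧ ∀ i ∉ W, 0 < f (g i) := by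
  classical
  obtain ⟨u, hu⟩ := h.exists_notMem
  obtain ⟨f, -, hfW, hf⟩ := h.balanced.isCut_of_insert (S := ∅) (i := u) (by simp) (by simp)
    (h.cut u hu)
  exact ⟨f, hfW, fun i hi => hf i (by simp) hi⟩

/-- White points lie in the convex hull of the black ones. -/
lemma IsTConfig.exists_cone (h : IsTConfig d g W) {w : ι} (hw : w ∈ W) :
    ∃ c : ι → ℝ, (∀ i, 0 ≤ c i) ∧ (∀ i ∈ W, c i = 0) ∧ ∑ i, c i • g i = -g w := by
  classical
  obtain ⟨c, hc1, hc2, hc⟩ := exists_pos_dependence (g := g) (U := insert w (Finset.univ \ W))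
    fun f hf => by
      by_contra hf0
      have := h.balanced.le_card_of_neg hf0 (s := W.erase w) fun i hi => by
        rw [Finset.mem_erase]
        refine ⟨fun hiw => ?_, ?_⟩
        · exact (hf i (by simp [hiw])).not_gt hi
        · by_contra hiW
          exact (hf i (by simp [hiW])).not_gt hi
      rw [Finset.card_erase_of_mem hw, h.card] at this
      omega
  have hcw : 0 < c w := hc1 w (by simp)
  have hc0 : ∀ i, 0 ≤ c i := fun i => by
    by_cases hi : i ∈ insert w (Finset.univ \ W)
    · exact (hc1 i hi).le
    · exact (hc2 i hi).ge
  refine ⟨fun i => if i = w then 0 else c i / c w, fun i => ?_, fun i hi => ?_, ?_⟩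
  · beta_reduce
    split_ifs
    · exact le_rfl
    · exact div_nonneg (hc0 i) hcw.le
  · beta_reduce
    split_ifs with hiw
    · rfl
    · rw [hc2 i (by simp [hiw, hi]), zero_div]
  · have h1 : ∑ i, (c i / c w) • g i = 0 := by
      simp only [div_eq_inv_mul, mul_smul, ← Finset.smul_sum, hc, smul_zero]
    rw [← Finset.add_sum_erase _ _ (Finset.mem_univ w), div_self hcw.ne', one_smul] at h1
    beta_reduce
    rw [← Finset.add_sum_erase _ _ (Finset.mem_univ w), if_pos rfl, zero_smul, zero_add,
      eq_neg_iff_add_eq_zero, ← h1, add_comm]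
    congr 1
    exact Finset.sum_congr rfl fun i hi => by rw [if_neg (Finset.ne_of_mem_erase hi)]

/-- If the chord through the black points `x`, `z` separates the white point `w` from some black
points, then `w` lies in the convex hull of the other ones. -/
lemma IsTConfig.exists_cone_of_chord (hT : IsTConfig d g W) {x z w : ι} (hx : x ∉ W) (hz : z ∉ W)
    (hxz : x ≠ z) (hw : w ∈ W) {h : (Fin 3 → ℝ) →ₗ[ℝ] ℝ} (hhx : h (g x) = 0)
    (hhz : h (g z) = 0) (hhw : 0 < h (g w)) :
    ∃ c : ι → ℝ, (∀ i, 0 ≤ c i) ∧ (∀ i, i ∈ W ∨ 0 < h (g i) → c i = 0) ∧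
      ∑ i, c i • g i = -g w := by
  classical
  obtain ⟨c, hc0, hcW, hc⟩ := hT.exists_cone hw
  set P := ∑ i, (if 0 < h (g i) then 0 else c i) • g i with hP
  set Q := ∑ i, (if 0 < h (g i) then c i else 0) • g i with hQ
  have hPQ : P + Q = -g w := by
    rw [← hc, hP, hQ, ← Finset.sum_add_distrib]
    exact Finset.sum_congr rfl fun i _ => by split_ifs <;> simp
  have hhQ : 0 ≤ h Q := by
    rw [hQ, map_sum]
    refine Finset.sum_nonneg fun i _ => ?_
    rw [map_smul, smul_eq_mul]
    split_ifs with hi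
    · exact mul_nonneg (hc0 i) hi.le
    · simp
  have hhPQ : h P + h Q = -h (g w) := by rw [← map_add, hPQ, map_neg]
  have hhP : h P < 0 := by linarith
  set s := -h Q / h P with hs
  have hs0 : 0 ≤ s := div_nonneg_of_nonpos (by linarith) hhP.le
  have hs1 : s ≤ 1 := (div_le_one_of_neg hhP).2 (by linarith)
  -- the point where the segment from `P` to `Q` meets the chord
  set R := s • P + Q with hR
  have hhR : h R = 0 := by
    have := hhP.ne
    simp only [hR, hs, map_add, map_smul, smul_eq_mul]; field_simp; ring
  have hRsupp : ∀ f : (Fin 3 → ℝ) →ₗ[ℝ] ℝ, (∀ i ∉ W, 0 ≤ f (g i)) → 0 ≤ f R := fun f hf => by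
    have h1 : ∀ i, 0 ≤ c i * f (g i) := fun i => by
      by_cases hi : i ∈ W
      · simp [hcW i hi]
      · exact mul_nonneg (hc0 i) (hf i hi)
    rw [hR, map_add, map_smul, hP, hQ, map_sum, map_sum, smul_eq_mul]
    refine add_nonneg (mul_nonneg hs0 (Finset.sum_nonneg fun i _ => ?_))
      (Finset.sum_nonneg fun i _ => ?_)
    all_goals
      rw [map_smul, smul_eq_mul]
      split_ifs
      all_goals first | exact h1 i | exact (zero_mul _).ge
  have hxw : x ≠ w := fun h => hx (h ▸ hw)
  have hzw : z ≠ w := fun h => hz (h ▸ hw)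
  have hb := hT.balanced.bracket_ne_zero hxz hxw hzw
  obtain ⟨b, e, hRbe⟩ : ∃ b e : ℝ, R = b • g x + e • g z := by
    have h1 := cramer_apply h (g x) (g z) (g w) R
    rw [hhx, hhz, hhR] at h1
    have h2 : bracket (g x) (g z) R = 0 := by
      have : bracket (g x) (g z) R * h (g w) = 0 := by linarith
      exact (mul_eq_zero.1 this).resolve_right hhw.ne'
    have h3 := cramer (g x) (g z) (g w) R
    rw [h2, zero_smul, add_zero, sub_eq_zero] at h3
    refine ⟨(bracket (g x) (g z) (g w))⁻¹ * bracket (g z) (g w) R,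
      -((bracket (g x) (g z) (g w))⁻¹ * bracket (g x) (g w) R), ?_⟩
    rw [mul_smul, neg_smul, mul_smul, ← sub_eq_add_neg, ← smul_sub, h3, smul_smul,
      inv_mul_cancel₀ hb, one_smul]
  have he : 0 ≤ e := by
    obtain ⟨f, hf0, -, hf⟩ := hT.exists_support hx
    have := hRsupp f fun i hi => by
      by_cases hix : i = x
      · rw [hix, hf0]
      · exact (hf i hi hix).le
    rw [hRbe, map_add, map_smul, map_smul, hf0, smul_zero, zero_add, smul_eq_mul] at this
    exact nonneg_of_mul_nonneg_left this (hf z hz hxz.symm)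
  have hb0 : 0 ≤ b := by
    obtain ⟨f, hf0, -, hf⟩ := hT.exists_support hz
    have := hRsupp f fun i hi => by
      by_cases hix : i = z
      · rw [hix, hf0]
      · exact (hf i hi hix).le
    rw [hRbe, map_add, map_smul, map_smul, hf0, smul_zero, add_zero, smul_eq_mul] at this
    exact nonneg_of_mul_nonneg_left this (hf x hx hxz)
  refine ⟨fun i => (1 - s) * (if 0 < h (g i) then 0 else c i) +
    (Pi.single x b + Pi.single z e : ι → ℝ) i, fun i => ?_, fun i hi => ?_, ?_⟩
  · refine add_nonneg (mul_nonneg (by linarith) ?_) ?_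
    · split_ifs
      · exact le_rfl
      · exact hc0 i
    · simp only [Pi.add_apply, Pi.single_apply]
      split_ifs <;> positivity
  · have hix : i ≠ x := by
      rintro rfl; rcases hi with hi | hi
      · exact hx hi
      · exact hi.ne' hhx
    have hiz : i ≠ z := by
      rintro rfl; rcases hi with hi | hi
      · exact hz hi
      · exact hi.ne' hhz
    rcases hi with hi | hi
    · simp [hix, hiz, hcW i hi]
    · simp [hix, hiz, hi]
  · have h1 : ∑ i, (Pi.single x b + Pi.single z e : ι → ℝ) i • g i = R := by
      rw [hRbe]
      simp [Pi.single_apply, add_smul, Finset.sum_add_distrib, ite_smul]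
    have h2 : ∑ i, ((1 - s) * (if 0 < h (g i) then 0 else c i)) • g i = (1 - s) • P := by
      simp only [hP, Finset.smul_sum, mul_smul]
    rw [Finset.sum_congr rfl fun i _ => add_smul _ _ (g i), Finset.sum_add_distrib, h1, h2, hR,
      ← hPQ]
    module

/-! ### The colours are determined by the configuration -/

/-- Two colourings of the same configuration have at most two common black points: for three of
them and a fourth point `x`, black in the first colouring and white in the second, the four points
are in convex position in the first diagram, which makes one of the three a convex combination of
the others in the second. -/
lemma IsTConfig.card_common_black_le_two [DecidableEq ι] {W₁ W₂ : Finset ι}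
    (h₁ : IsTConfig d g W₁) (h₂ : IsTConfig d g W₂) {x : ι} (hx₁ : x ∉ W₁) (hx₂ : x ∈ W₂) :
    (Finset.univ \ (W₁ ∪ W₂)).card ≤ 2 := by
  by_contra! hlt
  obtain ⟨t, ht, ht3⟩ := Finset.exists_subset_card_eq hlt
  obtain ⟨a, b, c, hab, hac, hbc, rfl⟩ := Finset.card_eq_three.1 ht3
  simp only [Finset.insert_subset_iff, Finset.singleton_subset_iff, Finset.mem_sdiff,
    Finset.mem_univ, true_and, Finset.mem_union, not_or] at ht
  obtain ⟨⟨ha₁, ha₂⟩, ⟨hb₁, hb₂⟩, hc₁, hc₂⟩ := ht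
  have hxa : x ≠ a := fun h => ha₂ (h ▸ hx₂)
  have hxb : x ≠ b := fun h => hb₂ (h ▸ hx₂)
  have hxc : x ≠ c := fun h => hc₂ (h ▸ hx₂)
  obtain ⟨α, β, γ, ξ, hα, hβ, hγ, hξ, hdep⟩ : ∃ α β γ ξ : ℝ, α ≠ 0 ∧ β ≠ 0 ∧ γ ≠ 0 ∧ 0 < ξ ∧
      α • g a + β • g b + γ • g c + ξ • g x = 0 := by
    have h1 := h₁.balanced.bracket_ne_zero hab hac hbc
    have h2 := h₁.balanced.bracket_ne_zero hab hxa.symm hxb.symm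
    have h3 := h₁.balanced.bracket_ne_zero hac hxa.symm hxc.symm
    have h4 := h₁.balanced.bracket_ne_zero hbc hxb.symm hxc.symm
    have h0 := cramer (g a) (g b) (g c) (g x)
    rcases lt_or_gt_of_ne h1 with h | h
    · refine ⟨_, -_, _, -_, h4, neg_ne_zero.2 h3, h2, neg_pos.2 h, ?_⟩
      rw [← h0]; module
    · refine ⟨-_, _, -_, _, neg_ne_zero.2 h4, h3, neg_ne_zero.2 h2, h, ?_⟩
      rw [← neg_zero, ← h0]; module
  have happ : ∀ f : (Fin 3 → ℝ) →ₗ[ℝ] ℝ,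
      α * f (g a) + β * f (g b) + γ * f (g c) + ξ * f (g x) = 0 := fun f => by
    simpa using congrArg f hdep
  -- a dependence of sign type `+++-` would put a black point of the first diagram into a triangle
  have key₁ : ∀ u ∉ W₁, ∃ f : (Fin 3 → ℝ) →ₗ[ℝ] ℝ, f (g u) = 0 ∧
      α * f (g a) + β * f (g b) + γ * f (g c) + ξ * f (g x) = 0 ∧
      (a ≠ u → 0 < f (g a)) ∧ (b ≠ u → 0 < f (g b)) ∧ (c ≠ u → 0 < f (g c)) ∧
      (x ≠ u → 0 < f (g x)) := fun u hu => by
    obtain ⟨f, hf0, -, hf⟩ := h₁.exists_support hu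
    exact ⟨f, hf0, happ f, hf a ha₁, hf b hb₁, hf c hc₁, hf x hx₁⟩
  have key₂ : ∀ u ∉ W₂, ∃ f : (Fin 3 → ℝ) →ₗ[ℝ] ℝ, f (g u) = 0 ∧
      α * f (g a) + β * f (g b) + γ * f (g c) + ξ * f (g x) = 0 ∧
      (a ≠ u → 0 < f (g a)) ∧ (b ≠ u → 0 < f (g b)) ∧ (c ≠ u → 0 < f (g c)) ∧
      ξ * f (g x) < 0 := fun u hu => by
    obtain ⟨f, hf0, hf2, hf⟩ := h₂.exists_support hu
    exact ⟨f, hf0, happ f, hf a ha₂, hf b hb₂, hf c hc₂, mul_neg_of_pos_of_neg hξ (hf2 x hx₂)⟩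
  rcases lt_or_gt_of_ne hα with hα | hα <;> rcases lt_or_gt_of_ne hβ with hβ | hβ <;>
    rcases lt_or_gt_of_ne hγ with hγ | hγ
  · obtain ⟨f, h0, h, ha, hb, hc, -⟩ := key₁ x hx₁
    have := mul_neg_of_neg_of_pos hα (ha hxa.symm)
    have := mul_neg_of_neg_of_pos hβ (hb hxb.symm)
    have := mul_neg_of_neg_of_pos hγ (hc hxc.symm)
    rw [h0] at h; linarith
  · obtain ⟨f, h0, h, ha, hb, -, hx⟩ := key₂ c hc₂
    have := mul_neg_of_neg_of_pos hα (ha hac)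
    have := mul_neg_of_neg_of_pos hβ (hb hbc)
    rw [h0] at h; linarith
  · obtain ⟨f, h0, h, ha, -, hc, hx⟩ := key₂ b hb₂
    have := mul_neg_of_neg_of_pos hα (ha hab)
    have := mul_neg_of_neg_of_pos hγ (hc hbc.symm)
    rw [h0] at h; linarith
  · obtain ⟨f, h0, h, -, hb, hc, hx⟩ := key₁ a ha₁
    have := mul_pos hβ (hb hab.symm)
    have := mul_pos hγ (hc hac.symm)
    have := mul_pos hξ (hx hxa)
    rw [h0] at h; linarith
  · obtain ⟨f, h0, h, -, hb, hc, hx⟩ := key₂ a ha₂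
    have := mul_neg_of_neg_of_pos hβ (hb hab.symm)
    have := mul_neg_of_neg_of_pos hγ (hc hac.symm)
    rw [h0] at h; linarith
  · obtain ⟨f, h0, h, ha, -, hc, hx⟩ := key₁ b hb₁
    have := mul_pos hα (ha hab)
    have := mul_pos hγ (hc hbc.symm)
    have := mul_pos hξ (hx hxb)
    rw [h0] at h; linarith
  · obtain ⟨f, h0, h, ha, hb, -, hx⟩ := key₁ c hc₁
    have := mul_pos hα (ha hac)
    have := mul_pos hβ (hb hbc)
    have := mul_pos hξ (hx hxc)
    rw [h0] at h; linarith
  · obtain ⟨f, h0, h, -, hb, hc, hx⟩ := key₁ a ha₁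
    have := mul_pos hβ (hb hab.symm)
    have := mul_pos hγ (hc hac.symm)
    have := mul_pos hξ (hx hxa)
    rw [h0] at h; linarith

/-- For `d ≥ 2` a configuration admits at most one colouring that makes it a T-diagram. Otherwise
all but two of the black points are white in the other colouring; a chord that cuts them off from
these two has a white point on their side, which then lies in the convex hull of points of the
other colour in both diagrams. -/
lemma IsTConfig.eq_of_two_le (hd : 2 ≤ d) {W₁ W₂ : Finset ι} (h₁ : IsTConfig d g W₁)
    (h₂ : IsTConfig d g W₂) : W₁ = W₂ := by
  classical
  by_contra hne
  obtain ⟨x₀, hx₀₂, hx₀₁⟩ : ∃ x ∈ W₂, x ∉ W₁ := by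
    by_contra! hsub
    exact hne (Finset.eq_of_subset_of_card_le hsub (by rw [h₁.card, h₂.card])).symm
  have hcom := h₁.card_common_black_le_two h₂ hx₀₁ hx₀₂
  have hui := Finset.card_union_add_card_inter W₁ W₂
  rw [Finset.card_sdiff_of_subset (Finset.subset_univ _), Finset.card_univ, h₁.balanced.1] at hcom
  rw [h₁.card, h₂.card] at hui
  have hdisj : ∀ i ∈ W₂, i ∉ W₁ := fun i hi₂ hi₁ => by
    have : W₁ ∩ W₂ = ∅ := Finset.card_eq_zero.1 (by omega)
    have hi : i ∈ W₁ ∩ W₂ := Finset.mem_inter.2 ⟨hi₁, hi₂⟩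
    simp [this] at hi
  set S := Finset.univ \ (W₁ ∪ W₂) with hS
  have hScard : S.card ≤ 2 := by
    rw [hS, Finset.card_sdiff_of_subset (Finset.subset_univ _), Finset.card_univ, h₁.balanced.1]
    exact hcom
  have hmemS : ∀ i, i ∈ S ↔ i ∉ W₁ ∧ i ∉ W₂ := by simp [hS]
  obtain ⟨l₁, -, hl₁⟩ := h₁.exists_level
  obtain ⟨l₂, hl₂W, hl₂⟩ := h₂.exists_level
  -- move the line that separates `W₂` from the rest of the black points until it meets `W₂`
  obtain ⟨x, hx, hxmin⟩ := Finset.exists_min_image W₂ (fun i => -l₂ (g i) / l₁ (g i)) ⟨x₀, hx₀₂⟩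
  have hl₁x := hl₁ x (hdisj x hx)
  set t := -l₂ (g x) / l₁ (g x) with ht
  have ht0 : 0 < t := div_pos (by linarith [hl₂W x hx]) hl₁x
  set f := l₂ + t • l₁ with hf
  have hfx : f (g x) = 0 := by
    simp only [hf, ht, LinearMap.add_apply, LinearMap.smul_apply, smul_eq_mul]; field_simp; ring
  have hfW : ∀ i ∈ W₂, f (g i) ≤ 0 := fun i hi => by
    have := hxmin i hi
    rw [le_div_iff₀ (hl₁ i (hdisj i hi))] at this
    simp only [hf, LinearMap.add_apply, LinearMap.smul_apply, smul_eq_mul]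
    linarith
  have hfS : ∀ i ∈ S, 0 < f (g i) := fun i hi => by
    have h1 := hl₂ i ((hmemS i).1 hi).2
    have h2 := mul_pos ht0 (hl₁ i ((hmemS i).1 hi).1)
    simp only [hf, LinearMap.add_apply, LinearMap.smul_apply, smul_eq_mul]
    linarith
  -- and turn it about the point met until it meets a second one
  obtain ⟨k, hk0, -, hk⟩ := h₁.exists_support (hdisj x hx)
  obtain ⟨z, hz, hzmin⟩ := Finset.exists_min_image (W₂.erase x) (fun i => -f (g i) / k (g i))
    (Finset.card_pos.1 (by rw [Finset.card_erase_of_mem hx, h₂.card]; omega))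
  have hz₂ := Finset.mem_of_mem_erase hz
  have hzx := Finset.ne_of_mem_erase hz
  have hkz := hk z (hdisj z hz₂) hzx
  set s := -f (g z) / k (g z) with hs
  have hs0 : 0 ≤ s := div_nonneg (by linarith [hfW z hz₂]) hkz.le
  set h := f + s • k with hh
  have hhx : h (g x) = 0 := by simp [hh, hfx, hk0]
  have hhz : h (g z) = 0 := by
    simp only [hh, hs, LinearMap.add_apply, LinearMap.smul_apply, smul_eq_mul]; field_simp; ring
  have hhS : ∀ i ∈ S, 0 < h (g i) := fun i hi => by
    have hix : i ≠ x := fun e => ((hmemS i).1 hi).2 (e ▸ hx)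
    have h1 := mul_nonneg hs0 (hk i ((hmemS i).1 hi).1 hix).le
    have h2 := hfS i hi
    simp only [hh, LinearMap.add_apply, LinearMap.smul_apply, smul_eq_mul]
    linarith
  have hhW : ∀ i ∈ W₂, h (g i) ≤ 0 := fun i hi => by
    by_cases hix : i = x
    · rw [hix, hhx]
    · have := hzmin i (Finset.mem_erase.2 ⟨hix, hi⟩)
      rw [le_div_iff₀ (hk i (hdisj i hi) hix)] at this
      simp only [hh, LinearMap.add_apply, LinearMap.smul_apply, smul_eq_mul]
      linarith
  obtain ⟨u, hu⟩ := h₁.balanced.exists_notMem (W₁ ∪ W₂) (by omega)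
  have hh0 : h ≠ 0 := fun h0 => by
    have := hhS u (by simpa [hS] using hu)
    simp [h0] at this
  obtain ⟨w, hw, hhw⟩ : ∃ w ∈ W₁, 0 < h (g w) := by
    by_contra! hle
    have := h₁.balanced.le_card_of_pos hh0 (s := S) fun i hi => by
      rw [hmemS]
      exact ⟨fun h => (hle i h).not_gt hi, fun h => (hhW i h).not_gt hi⟩
    omega
  obtain ⟨c, hc0, hcz, hc⟩ := h₁.exists_cone_of_chord (hdisj x hx) (hdisj z hz₂) hzx.symm hw hhx hhz
    hhw
  have hw₂ : w ∉ W₂ := fun h => hdisj w h hw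
  obtain ⟨l, hlw, hlW, -⟩ := h₂.exists_support hw₂
  have hle : ∀ i, c i * l (g i) ≤ 0 := fun i => by
    by_cases hi : i ∈ W₂
    · exact mul_nonpos_of_nonneg_of_nonpos (hc0 i) (hlW i hi).le
    · rw [hcz i, zero_mul]
      by_cases hi₁ : i ∈ W₁
      · exact Or.inl hi₁
      · exact Or.inr (hhS i ((hmemS i).2 ⟨hi₁, hi⟩))
  have hsum : ∑ i, c i * l (g i) = 0 := by
    have := congrArg l hc
    simpa [hlw] using this
  have hczero : ∀ i, c i = 0 := fun i => by
    by_cases hi : i ∈ W₂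
    · have := (Finset.sum_eq_zero_iff_of_nonpos fun i _ => hle i).1 hsum i (Finset.mem_univ i)
      exact (mul_eq_zero.1 this).resolve_right (hlW i hi).ne
    · apply hcz i
      by_cases hi₁ : i ∈ W₁
      · exact Or.inl hi₁
      · exact Or.inr (hhS i ((hmemS i).2 ⟨hi₁, hi⟩))
  have hgw : g w = 0 := by simpa [hczero] using hc.symm
  rw [hgw, map_zero] at hhw
  exact lt_irrefl _ hhw

/-! ### Cofacets in terms of the sides of diagonals -/

lemma IsBalanced.isCofacet_iff (hg : IsBalanced d g) {i j k l : ι}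
    (hne : i ≠ j ∧ i ≠ k ∧ i ≠ l ∧ j ≠ k ∧ j ≠ l ∧ k ≠ l) :
    IsCofacet g i j k l ↔
      SignType.sign (bracket (g i) (g k) (g l)) = -SignType.sign (bracket (g j) (g k) (g l)) ∧
      SignType.sign (bracket (g i) (g j) (g l)) = SignType.sign (bracket (g j) (g k) (g l)) ∧
      SignType.sign (bracket (g i) (g j) (g k)) = -SignType.sign (bracket (g j) (g k) (g l)) := by
  constructor
  · rintro ⟨a, b, c, e, ha, hb, hc, he, h⟩
    have key : ∀ {s t u v : ℝ}, 0 < s → 0 < t → s * u + t * v = 0 →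
        SignType.sign u = -SignType.sign v := fun {s t u v} hs ht h => by
      have : s * u = -(t * v) := by linarith
      have := congrArg SignType.sign this
      rwa [Left.sign_neg, sign_mul, sign_mul, sign_pos hs, sign_pos ht, one_mul, one_mul] at this
    have h1 := congrArg (bracketL (g k) (g l)) h
    have h2 := congrArg (bracketL (g j) (g l)) h
    have h3 := congrArg (bracketL (g j) (g k)) h
    simp only [map_add, map_smul, bracketL_apply, bracket_self_right, bracket_self_outer, smul_eq_mul,
      mul_zero, add_zero, map_zero] at h1 h2 h3
    rw [bracket_rotate (g i) (g k), bracket_rotate (g j) (g k)] at h1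
    rw [bracket_rotate (g i) (g j), bracket_swap_right (g j) (g k) (g l), mul_neg,
      ← mul_neg] at h2
    rw [bracket_rotate (g i) (g j)] at h3
    have h2' := key ha hc h2
    rw [Left.sign_neg, neg_neg] at h2'
    exact ⟨key ha hb h1, h2', key ha he h3⟩
  · rintro ⟨h1, h2, h3⟩
    have h0 := cramer (g i) (g j) (g k) (g l)
    rcases lt_or_gt_of_ne (hg.bracket_ne_zero hne.2.2.2.1 hne.2.2.2.2.1 hne.2.2.2.2.2) with h | h
    · rw [sign_neg h] at h1 h2 h3
      refine ⟨_, _, _, _, neg_pos.2 h, sign_eq_one_iff.1 (h1.trans (neg_neg 1)),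
        neg_pos.2 (sign_eq_neg_one_iff.1 h2), sign_eq_one_iff.1 (h3.trans (neg_neg 1)), ?_⟩
      rw [← neg_zero, ← h0]; module
    · rw [sign_pos h] at h1 h2 h3
      refine ⟨_, _, _, _, h, neg_pos.2 (sign_eq_neg_one_iff.1 h1), sign_eq_one_iff.1 h2,
        neg_pos.2 (sign_eq_neg_one_iff.1 h3), ?_⟩
      rw [← h0]; module

/-- Two black and two white points form a cofacet iff the white ones are on different sides of the
diagonal through the black ones. -/
lemma IsTConfig.isCofacet_iff_of_two (hT : IsTConfig d g W) {x y v w : ι} (hx : x ∉ W)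
    (hy : y ∉ W) (hv : v ∈ W) (hw : w ∈ W) (hxy : x ≠ y) (hvw : v ≠ w) :
    IsCofacet g x y v w ↔
      SignType.sign (bracket (g x) (g y) (g w)) = -SignType.sign (bracket (g x) (g y) (g v)) := by
  have hxv : x ≠ v := fun h => hx (h ▸ hv)
  have hxw : x ≠ w := fun h => hx (h ▸ hw)
  have hyv : y ≠ v := fun h => hy (h ▸ hv)
  have hyw : y ≠ w := fun h => hy (h ▸ hw)
  constructor
  · intro h
    obtain ⟨h1, h2, h3⟩ := (hT.balanced.isCofacet_iff ⟨hxy, hxv, hxw, hyv, hyw, hvw⟩).1 h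
    rw [h2, h3, neg_neg]
  · intro h
    obtain ⟨α, β, γ, δ, hγ, hδ, hdep⟩ : ∃ α β γ δ : ℝ, 0 < γ ∧ 0 < δ ∧
        α • g x + β • g y + γ • g v + δ • g w = 0 := by
      have h0 := cramer (g x) (g y) (g v) (g w)
      rcases lt_or_gt_of_ne (hT.balanced.bracket_ne_zero hxy hxv hyv) with hb | hb
      · rw [sign_neg hb] at h
        refine ⟨bracket (g y) (g v) (g w), -bracket (g x) (g v) (g w), _, _,
          sign_eq_one_iff.1 (h.trans (neg_neg 1)), neg_pos.2 hb, ?_⟩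
        · rw [← h0]; module
      · rw [sign_pos hb] at h
        refine ⟨-bracket (g y) (g v) (g w), bracket (g x) (g v) (g w), _, _,
          neg_pos.2 (sign_eq_neg_one_iff.1 h), hb, ?_⟩
        · rw [← neg_zero, ← h0]; module
    refine ⟨α, β, γ, δ, ?_, ?_, hγ, hδ, hdep⟩
    · obtain ⟨f, hf0, hfW, hf⟩ := hT.exists_support hy
      have := congrArg f hdep
      simp only [map_add, map_smul, hf0, smul_eq_mul, mul_zero, add_zero, map_zero] at this
      have h1 := mul_neg_of_pos_of_neg hγ (hfW v hv)
      have h2 := mul_neg_of_pos_of_neg hδ (hfW w hw)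
      exact pos_of_mul_pos_left (show 0 < α * f (g x) by linarith) (hf x hx hxy).le
    · obtain ⟨f, hf0, hfW, hf⟩ := hT.exists_support hx
      have := congrArg f hdep
      simp only [map_add, map_smul, hf0, smul_eq_mul, mul_zero, zero_add, map_zero] at this
      have h1 := mul_neg_of_pos_of_neg hγ (hfW v hv)
      have h2 := mul_neg_of_pos_of_neg hδ (hfW w hw)
      exact pos_of_mul_pos_left (show 0 < β * f (g y) by linarith) (hf y hy hxy.symm).le

lemma IsTConfig.not_isCofacet_of_white (hT : IsTConfig d g W) {i j k l : ι} (hi : i ∈ W)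
    (hj : j ∈ W) (hk : k ∈ W) : ¬ IsCofacet g i j k l := by
  rintro ⟨a, b, c, e, ha, hb, hc, he, h⟩
  obtain ⟨f, hfW, hfl⟩ : ∃ f : (Fin 3 → ℝ) →ₗ[ℝ] ℝ, (∀ i ∈ W, f (g i) < 0) ∧ f (g l) ≤ 0 := by
    by_cases hl : l ∈ W
    · obtain ⟨f, hfW, -⟩ := hT.exists_level
      exact ⟨f, hfW, (hfW l hl).le⟩
    · obtain ⟨f, hf0, hfW, -⟩ := hT.exists_support hl
      exact ⟨f, hfW, hf0.le⟩
  have h0 := congrArg f h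
  simp only [map_add, map_smul, smul_eq_mul, map_zero] at h0
  have h1 := mul_neg_of_pos_of_neg ha (hfW i hi)
  have h2 := mul_neg_of_pos_of_neg hb (hfW j hj)
  have h3 := mul_neg_of_pos_of_neg hc (hfW k hk)
  have h4 := mul_nonpos_of_nonneg_of_nonpos he.le hfl
  linarith

lemma IsTConfig.not_isCofacet_of_black (hT : IsTConfig d g W) {i j k l : ι} (hi : i ∉ W)
    (hj : j ∉ W) (hk : k ∉ W) (hl : l ∉ W) : ¬ IsCofacet g i j k l := by
  rintro ⟨a, b, c, e, ha, hb, hc, he, h⟩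
  obtain ⟨f, -, hf⟩ := hT.exists_level
  have h0 := congrArg f h
  simp only [map_add, map_smul, smul_eq_mul, map_zero] at h0
  have h1 := mul_pos ha (hf i hi)
  have h2 := mul_pos hb (hf j hj)
  have h3 := mul_pos hc (hf k hk)
  have h4 := mul_pos he (hf l hl)
  linarith

section Diagonals

variable {κ : Type*} [Fintype κ] {g' : κ → Fin 3 → ℝ} {W' : Finset κ}

/-- A colour preserving bijection that respects the sides of all diagonals joining black points. -/
def RespectsDiagonals {ι κ : Type*} (g : ι → Fin 3 → ℝ) (W : Finset ι) (g' : κ → Fin 3 → ℝ) (W' : Finset κ)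
    (σ : ι ≃ κ) : Prop :=
  (∀ i, σ i ∈ W' ↔ i ∈ W) ∧ ∃ s : SignType, s ≠ 0 ∧ ∀ i ∉ W, ∀ j ∉ W, ∀ k,
    SignType.sign (bracket (g' (σ i)) (g' (σ j)) (g' (σ k))) =
      s * SignType.sign (bracket (g i) (g j) (g k))

lemma RespectsDiagonals.symm {ι κ : Type*} {g : ι → Fin 3 → ℝ} {W : Finset ι}
    {g' : κ → Fin 3 → ℝ} {W' : Finset κ} {σ : ι ≃ κ} (h : RespectsDiagonals g W g' W' σ) :
    RespectsDiagonals g' W' g W σ.symm := by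
  obtain ⟨hW, s, hs, h⟩ := h
  refine ⟨fun i => by rw [← hW, σ.apply_symm_apply], s, hs, fun i hi j hj k => ?_⟩
  have := h (σ.symm i) (by rwa [← hW, σ.apply_symm_apply]) (σ.symm j)
    (by rwa [← hW, σ.apply_symm_apply]) (σ.symm k)
  simp only [σ.apply_symm_apply] at this
  rw [this, ← mul_assoc]
  have : ∀ s : SignType, s ≠ 0 → s * s = 1 := by decide
  rw [this s hs, one_mul]

lemma RespectsDiagonals.isCofacet {σ : ι ≃ κ} (hσ : RespectsDiagonals g W g' W' σ)
    (hT : IsTConfig d g W) (hT' : IsTConfig d g' W') {i j k l : ι}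
    (hne : i ≠ j ∧ i ≠ k ∧ i ≠ l ∧ j ≠ k ∧ j ≠ l ∧ k ≠ l) (h : IsCofacet g i j k l) :
    IsCofacet g' (σ i) (σ j) (σ k) (σ l) := by
  obtain ⟨hW, s, hs, hsign⟩ := hσ
  have h1 : ∀ {i j k l : ι}, i ∉ W → j ∉ W → k ∉ W → l ∈ W →
      (i ≠ j ∧ i ≠ k ∧ i ≠ l ∧ j ≠ k ∧ j ≠ l ∧ k ≠ l) → IsCofacet g i j k l →
      IsCofacet g' (σ i) (σ j) (σ k) (σ l) := by
    intro i j k l hi hj hk hl hne h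
    rw [hT.balanced.isCofacet_iff hne] at h
    rw [hT'.balanced.isCofacet_iff (by simpa using hne), hsign i hi k hk, hsign j hj k hk,
      hsign i hi j hj, hsign i hi j hj, h.1, h.2.1, h.2.2]
    simp
  have h2 : ∀ {i j k l : ι}, i ∉ W → j ∉ W → k ∈ W → l ∈ W → i ≠ j → k ≠ l → IsCofacet g i j k l →
      IsCofacet g' (σ i) (σ j) (σ k) (σ l) := by
    intro i j k l hi hj hk hl hij hkl h
    rw [hT.isCofacet_iff_of_two hi hj hk hl hij hkl] at h
    rw [hT'.isCofacet_iff_of_two (by rwa [hW]) (by rwa [hW]) (by rwa [hW]) (by rwa [hW])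
      (by simpa using hij) (by simpa using hkl), hsign i hi j hj, hsign i hi j hj, h, mul_neg]
  obtain ⟨hij, hik, hil, hjk, hjl, hkl⟩ := hne
  by_cases hi : i ∈ W <;> by_cases hj : j ∈ W <;> by_cases hk : k ∈ W <;> by_cases hl : l ∈ W
  · exact absurd h (hT.not_isCofacet_of_white hi hj hk)
  · exact absurd h (hT.not_isCofacet_of_white hi hj hk)
  · exact absurd h.swap34 (hT.not_isCofacet_of_white hi hj hl)
  · exact (h2 hk hl hi hj hkl hij h.swap23.swap12.swap34.swap23).swap23.swap34.swap12.swap23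
  · exact absurd h.swap23.swap34 (hT.not_isCofacet_of_white hi hk hl)
  · exact (h2 hj hl hi hk hjl hik h.swap12.swap34.swap23).swap23.swap34.swap12
  · exact (h2 hj hk hi hl hjk hil h.swap12.swap23).swap23.swap12
  · exact (h1 hj hk hl hi ⟨hjk, hjl, hij.symm, hkl, hik.symm, hil.symm⟩
      h.swap12.swap23.swap34).swap34.swap23.swap12
  · exact absurd h.swap12.swap23.swap34 (hT.not_isCofacet_of_white hj hk hl)
  · exact (h2 hi hl hj hk hil hjk h.swap34.swap23).swap23.swap34
  · exact (h2 hi hk hj hl hik hjl h.swap23).swap23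
  · exact (h1 hi hk hl hj ⟨hik, hil, hij, hkl, hjk.symm, hjl.symm⟩ h.swap23.swap34).swap34.swap23
  · exact h2 hi hj hk hl hij hkl h
  · exact (h1 hi hj hl hk ⟨hij, hil, hik, hjl, hjk, hkl.symm⟩ h.swap34).swap34
  · exact h1 hi hj hk hl ⟨hij, hik, hil, hjk, hjl, hkl⟩ h
  · exact absurd h (hT.not_isCofacet_of_black hi hj hk hl)

lemma RespectsDiagonals.isGaleFace {σ : ι ≃ κ} (hσ : RespectsDiagonals g W g' W' σ)
    (hT : IsTConfig d g W) (hT' : IsTConfig d g' W') {M : Set ι} (hM : IsGaleFace g M) :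
    IsGaleFace g' (σ '' M) := by
  rw [hT.balanced.isGaleFace_iff] at hM
  rw [hT'.balanced.isGaleFace_iff]
  have hmem : ∀ i, σ i ∉ σ '' M ↔ i ∉ M := fun i => by rw [σ.injective.mem_set_image]
  intro u hu
  obtain ⟨u, rfl⟩ := σ.surjective u
  obtain ⟨i, j, k, hne, hi, hj, hk, h⟩ := hM u ((hmem u).1 hu)
  exact ⟨σ i, σ j, σ k, by simpa using hne, (hmem i).2 hi, (hmem j).2 hj, (hmem k).2 hk,
    hσ.isCofacet hT hT' hne h⟩

/-- The sides of the diagonals determine the faces. -/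
lemma RespectsDiagonals.isGaleFace_iff {σ : ι ≃ κ} (hσ : RespectsDiagonals g W g' W' σ)
    (hT : IsTConfig d g W) (hT' : IsTConfig d g' W') {M : Set ι} :
    IsGaleFace g M ↔ IsGaleFace g' (σ '' M) := by
  refine ⟨hσ.isGaleFace hT hT', fun h => ?_⟩
  have := hσ.symm.isGaleFace hT' hT h
  rwa [σ.symm_image_image] at this

end Diagonals

end TConfig

section Lift

/-! ### Vectors and points of a diagram -/

variable {ι : Type*} [Fintype ι]

open Classical in
/-- The colour of a label as a sign: `1` for black and `-1` for white. -/
noncomputable def colour {ι : Type*} (W : Finset ι) (i : ι) : SignType := if i ∈ W then -1 else 1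

lemma colour_ne_zero {ι : Type*} (W : Finset ι) (i : ι) : colour W i ≠ 0 := by
  unfold colour; split_ifs <;> decide

lemma colour_of_notMem {ι : Type*} {W : Finset ι} {i : ι} (hi : i ∉ W) : colour W i = 1 := by
  simp [colour, hi]

/-- The vectors `g` induce the diagram `X` with white points `W`: orientations of triples are the
signs of determinants, corrected by the colours, and convex hulls are cones. -/
structure IsLift (X : PlaneDiagram ι) (g : ι → Fin 3 → ℝ) (W : Finset ι) : Prop where
  mem_black_iff : ∀ i, i ∈ X.black ↔ i ∉ W
  orient : ∃ s : SignType, s ≠ 0 ∧ ∀ i j k, X.orient i j k =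
    s * colour W i * colour W j * colour W k * SignType.sign (bracket (g i) (g j) (g k))
  mem_convexHull_iff : ∀ b ∈ W, ∀ S : Set ι, (∀ i ∈ S, i ∉ W) →
    (X.point b ∈ convexHull ℝ (X.point '' S) ↔
      ∃ c : ι → ℝ, (∀ i, 0 ≤ c i) ∧ (∀ i ∉ S, c i = 0) ∧ ∑ i, c i • g i = -g b)

/-- The determinant of three points of an affinely embedded plane is proportional to the
orientation determinant of the triple. -/
lemma bracket_affineMap (φ : (Fin 2 → ℝ) →ᵃ[ℝ] (Fin 3 → ℝ)) : ∃ r : ℝ, ∀ x y z,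
    bracket (φ x) (φ y) (φ z) =
      r * ((y 0 - x 0) * (z 1 - x 1) - (y 1 - x 1) * (z 0 - x 0)) := by
  have hφ : ∀ x, φ x = φ 0 + x 0 • φ.linear (Pi.single 0 1) + x 1 • φ.linear (Pi.single 1 1) := by
    intro x
    have h1 : x = x 0 • Pi.single 0 1 + x 1 • Pi.single 1 1 := by
      ext i; fin_cases i <;> simp
    have h2 : φ x = φ.linear x + φ 0 := congrFun φ.decomp x
    rw [h2]
    nth_rewrite 1 [h1]
    rw [map_add, map_smul, map_smul]
    abel
  refine ⟨bracket (φ 0) (φ.linear (Pi.single 0 1)) (φ.linear (Pi.single 1 1)), fun x y z => ?_⟩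
  rw [hφ x, hφ y, hφ z]
  simp only [bracket, Pi.add_apply, Pi.smul_apply, smul_eq_mul]
  ring

/-- The vectors of a T-diagram form a configuration of the kind studied above, from which the
diagram is recovered. -/
lemma exists_isLift {d : ℕ} {p : ι → Fin (2 * d) → ℝ} {X : PlaneDiagram ι}
    (hX : IsTPolytopeWithDiagram d p X) :
    ∃ (g : ι → Fin 3 → ℝ) (W : Finset ι), IsGaleTransform p g ∧ IsTConfig d g W ∧
      IsLift X g W := by
  classical
  obtain ⟨hp, ⟨hcard, hblack, hconv, -⟩, g, hg, ℓ, φ, hφinj, hφ, hgX⟩ := hX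
  rw [Nat.card_eq_fintype_card] at hcard
  have hbal := isBalanced_of_isNeighborlyPolytope hp hcard hg
  set W : Finset ι := Finset.univ.filter fun i => i ∉ X.black with hWdef
  have hW : ∀ i, i ∈ X.black ↔ i ∉ W := fun i => by simp [hWdef]
  have hφℓ : ∀ x, ℓ (φ x) = 1 := fun x => by
    have : φ x ∈ {v | ℓ v = 1} := hφ ▸ mem_range_self x
    exact this
  have hgφ : ∀ i, g i = ℓ (g i) • φ (X.point i) := fun i => by
    rw [(hgX i).2.1, smul_smul, mul_inv_cancel₀ (hgX i).1, one_smul]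
  have hℓpos : ∀ i, i ∉ W → 0 < ℓ (g i) := fun i hi => (hgX i).2.2.1 ((hW i).2 hi)
  have hℓneg : ∀ i, i ∈ W → ℓ (g i) < 0 := fun i hi =>
    lt_of_le_of_ne (not_lt.1 fun h => (hW i).1 ((hgX i).2.2.2 h) hi) (hgX i).1
  have hWcard : W.card = d + 1 := by
    have h1 : (Finset.univ \ W).card = d + 3 := by
      rw [← hblack, Set.ncard_eq_toFinset_card']
      congr 1
      ext i; simp [hWdef]
    rw [Finset.card_sdiff_of_subset (Finset.subset_univ _), Finset.card_univ, hcard] at h1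
    omega
  refine ⟨g, W, hg, ⟨hbal, hWcard, fun u hu => ?_⟩, hW, ?_, fun b hb S hS => ?_⟩
  · -- a black point is separated from the other black points
    have hnot : X.point u ∉ convexHull ℝ (X.point '' (X.black \ {u})) := by
      have := (convexIndependent_iff_notMem_convexHull_sdiff.1 hconv) ⟨u, (hW u).2 hu⟩ univ
      convert this using 3
      ext x
      constructor
      · rintro ⟨i, ⟨hi, hiu⟩, rfl⟩
        exact ⟨⟨i, hi⟩, ⟨trivial, fun h => hiu (congrArg Subtype.val h)⟩, rfl⟩
      · rintro ⟨i, ⟨-, hiu⟩, rfl⟩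
        exact ⟨i, ⟨i.2, fun h => hiu (Subtype.ext h)⟩, rfl⟩
    have hnot' : φ (X.point u) ∉ φ '' convexHull ℝ (X.point '' (X.black \ {u})) := fun h =>
      hnot (hφinj.mem_set_image.1 h)
    rw [AffineMap.image_convexHull] at hnot'
    have hfin : (φ '' (X.point '' (X.black \ {u}))).Finite :=
      ((Set.toFinite _).image _).image _
    obtain ⟨F, s, hFu, hF⟩ := geometric_hahn_banach_point_closed (convex_convexHull ℝ _)
      (hfin.isClosed_convexHull ℝ) hnot'
    set G : (Fin 3 → ℝ) →ₗ[ℝ] ℝ := F.toLinearMap - F (φ (X.point u)) • ℓ with hG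
    have hGφ : ∀ x, G (φ x) = F (φ x) - F (φ (X.point u)) := fun x => by simp [hG, hφℓ]
    have hGu : G (g u) = 0 := by rw [hgφ u, map_smul, hGφ, sub_self, smul_zero]
    have hGpos : ∀ i ∉ W, i ≠ u → 0 < G (g i) := fun i hi hiu => by
      rw [hgφ i, map_smul, hGφ, smul_eq_mul]
      refine mul_pos (hℓpos i hi) ?_
      have := hF (φ (X.point i)) (subset_convexHull ℝ _ ⟨_, ⟨i, ⟨(hW i).2 hi, hiu⟩, rfl⟩, rfl⟩)
      linarith
    obtain ⟨k, hk⟩ := hbal.exists_notMem (insert u W) (by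
      rw [Finset.card_insert_of_notMem hu]; omega)
    simp only [Finset.mem_insert, not_or] at hk
    have hG0 : G ≠ 0 := fun h0 => by
      have := hGpos k hk.2 hk.1
      simp [h0] at this
    refine ⟨G, by simpa using hGu, fun w hw => ?_, fun i hiu hi => hGpos i hi (by simpa using hiu)⟩
    by_contra! hge
    have := hbal.le_card_of_neg hG0 (s := W.erase w) fun i hi => by
      rw [Finset.mem_erase]
      refine ⟨fun h => by rw [h] at hi; exact hge.not_gt hi, ?_⟩
      by_contra hiW
      by_cases hiu : i = u
      · rw [hiu, hGu] at hi; exact lt_irrefl _ hi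
      · exact (hGpos i hiW hiu).not_gt hi
    rw [Finset.card_erase_of_mem hw] at this
    omega
  · obtain ⟨r, hr⟩ := bracket_affineMap φ
    have hbr : ∀ i j k, bracket (g i) (g j) (g k) = ℓ (g i) * ℓ (g j) * ℓ (g k) *
        (r * ((X.point j 0 - X.point i 0) * (X.point k 1 - X.point i 1)
          - (X.point j 1 - X.point i 1) * (X.point k 0 - X.point i 0))) := fun i j k => by
      conv_lhs => rw [hgφ i, hgφ j, hgφ k, bracket_smul, hr]
    have hr0 : r ≠ 0 := by
      rintro rfl
      obtain ⟨i, -⟩ := hbal.exists_notMem ∅ (by simp)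
      obtain ⟨j, hj⟩ := hbal.exists_notMem {i} (by simp)
      obtain ⟨k, hk⟩ := hbal.exists_notMem {i, j} (by
        have := Finset.card_le_two (a := i) (b := j); omega)
      simp only [Finset.mem_insert, Finset.mem_singleton, not_or] at hj hk
      exact hbal.bracket_ne_zero (Ne.symm hj) (Ne.symm hk.1) (Ne.symm hk.2) (by rw [hbr]; ring)
    have hcol : ∀ i, SignType.sign (ℓ (g i)) = colour W i := fun i => by
      by_cases hi : i ∈ W
      · rw [sign_neg (hℓneg i hi)]; simp [colour, hi]
      · rw [sign_pos (hℓpos i hi)]; simp [colour, hi]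
    refine ⟨SignType.sign r, sign_ne_zero.2 hr0, fun i j k => ?_⟩
    rw [hbr, sign_mul, sign_mul, sign_mul, sign_mul, hcol, hcol, hcol]
    have hdec : ∀ s a b c o : SignType, s ≠ 0 → a ≠ 0 → b ≠ 0 → c ≠ 0 →
        o = s * a * b * c * (a * b * c * (s * o)) := by decide
    exact hdec _ _ _ _ _ (sign_ne_zero.2 hr0) (colour_ne_zero W i) (colour_ne_zero W j)
      (colour_ne_zero W k)
  · have hℓb := hℓneg b hb
    constructor
    · intro h
      set C : Set (Fin 3 → ℝ) := {v | ∃ c : ι → ℝ, (∀ i, 0 ≤ c i) ∧ (∀ i ∉ S, c i = 0) ∧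
        ∑ i, c i • g i = v} with hC
      have hCconv : Convex ℝ C := by
        rintro _ ⟨c, hc0, hcS, rfl⟩ _ ⟨c', hc'0, hc'S, rfl⟩ s t hs ht -
        refine ⟨fun i => s * c i + t * c' i, fun i => add_nonneg (mul_nonneg hs (hc0 i))
          (mul_nonneg ht (hc'0 i)), fun i hi => by simp [hcS i hi, hc'S i hi], ?_⟩
        simp only [add_smul, mul_smul, Finset.sum_add_distrib, Finset.smul_sum]
      have hsub : convexHull ℝ (X.point '' S) ⊆ φ ⁻¹' C := by
        refine convexHull_min ?_ (hCconv.affine_preimage φ)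
        rintro _ ⟨i, hi, rfl⟩
        have hℓi := hℓpos i (hS i hi)
        refine ⟨Pi.single i (ℓ (g i))⁻¹, fun j => ?_, fun j hj => ?_, ?_⟩
        · rw [Pi.single_apply]; split_ifs
          · exact inv_nonneg.2 hℓi.le
          · exact le_rfl
        · rw [Pi.single_apply, if_neg]; rintro rfl; exact hj hi
        · rw [(hgX i).2.1]
          simp [Pi.single_apply, ite_smul]
      obtain ⟨c, hc0, hcS, hc⟩ := hsub h
      refine ⟨fun i => -ℓ (g b) * c i, fun i => mul_nonneg (by linarith) (hc0 i),
        fun i hi => by simp [hcS i hi], ?_⟩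
      simp only [mul_smul, ← Finset.smul_sum, hc]
      rw [neg_smul, ← hgφ]
    · rintro ⟨c, hc0, hcS, hc⟩
      set t : ι → ℝ := fun i => c i * ℓ (g i) / -ℓ (g b) with ht
      have ht0 : ∀ i ∈ S, 0 ≤ t i := fun i hi =>
        div_nonneg (mul_nonneg (hc0 i) (hℓpos i (hS i hi)).le) (by linarith)
      have htS : ∀ i ∉ S, t i = 0 := fun i hi => by simp [ht, hcS i hi]
      have ht1 : ∑ i, t i = 1 := by
        have := congrArg ℓ hc
        simp only [map_sum, map_smul, map_neg, smul_eq_mul] at this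
        rw [ht, ← Finset.sum_div, this, div_self (by linarith)]
      have htφ : φ (X.point b) = ∑ i, t i • φ (X.point i) := by
        have h1 : ∀ i, t i • φ (X.point i) = (-ℓ (g b))⁻¹ • c i • g i := fun i => by
          conv_rhs => rw [hgφ i]
          rw [smul_smul, smul_smul]
          congr 1
          simp only [ht]; field_simp
        simp only [h1, ← Finset.smul_sum, hc]
        rw [smul_neg, inv_neg, neg_smul, neg_neg, (hgX b).2.1]
      have htX : X.point b = ∑ i, t i • X.point i := by
        apply hφinj
        rw [htφ]
        have := Finset.map_affineCombination Finset.univ X.point t ht1 φ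
        rw [Finset.affineCombination_eq_linear_combination _ _ _ ht1,
          Finset.affineCombination_eq_linear_combination _ _ _ ht1] at this
        rw [this]; rfl
      have hfil : ∀ (E : Type) [AddCommMonoid E] [Module ℝ E] (v : ι → E),
          ∑ i ∈ Finset.univ.filter (· ∈ S), t i • v i = ∑ i, t i • v i := fun E _ _ v => by
        rw [Finset.sum_filter]
        exact Finset.sum_congr rfl fun i _ => by
          split_ifs with h
          · rfl
          · rw [htS i h, zero_smul]
      rw [htX, ← hfil]
      refine (convex_convexHull ℝ _).sum_mem (fun i hi => ht0 i (by simpa using hi)) ?_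
        fun i hi => subset_convexHull ℝ _ ⟨i, by simpa using hi, rfl⟩
      have := hfil ℝ fun _ => 1
      simpa [ht1] using this

variable {d : ℕ} {g : ι → Fin 3 → ℝ} {W : Finset ι} {X : PlaneDiagram ι}

lemma IsLift.orient_ne_zero (hL : IsLift X g W) (hg : IsBalanced d g) {i j k : ι} (hij : i ≠ j)
    (hik : i ≠ k) (hjk : j ≠ k) : X.orient i j k ≠ 0 := by
  obtain ⟨s, hs, h⟩ := hL.orient
  rw [h]
  exact mul_ne_zero (mul_ne_zero (mul_ne_zero (mul_ne_zero hs (colour_ne_zero _ _))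
    (colour_ne_zero _ _)) (colour_ne_zero _ _)) (sign_ne_zero.2 (hg.bracket_ne_zero hij hik hjk))

/-- No three points of the diagram are collinear, so "lies between" holds only trivially. -/
lemma IsLift.wbtw_iff (hL : IsLift X g W) (hg : IsBalanced d g) (i j k : ι) :
    Wbtw ℝ (X.point i) (X.point j) (X.point k) ↔ i = j ∨ j = k := by
  classical
  constructor
  · intro h
    by_contra! hne
    obtain ⟨hij, hjk⟩ := hne
    obtain ⟨t, -, ht⟩ := h
    have hcoord : ∀ a, X.point j a = X.point i a + t * (X.point k a - X.point i a) := fun a => by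
      rw [← ht, AffineMap.lineMap_apply]; simp; ring
    by_cases hik : i = k
    · subst hik
      obtain ⟨l, hl⟩ := hg.exists_notMem {i, j} (by
        have := Finset.card_le_two (a := i) (b := j); omega)
      simp only [Finset.mem_insert, Finset.mem_singleton, not_or] at hl
      refine hL.orient_ne_zero hg hij (Ne.symm hl.1) (Ne.symm hl.2) ?_
      rw [PlaneDiagram.orient, hcoord 0, hcoord 1, sign_eq_zero_iff]; ring
    · refine hL.orient_ne_zero hg hij hik hjk ?_
      rw [PlaneDiagram.orient, hcoord 0, hcoord 1, sign_eq_zero_iff]; ring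
  · rintro (rfl | rfl)
    · exact wbtw_self_left ℝ _ _
    · exact wbtw_self_right ℝ _ _

/-! ### The cyclic order of the black points -/

/-- The black points can be numbered along the boundary of their convex hull, starting from any of
them: around a vertex `x` the others are sorted by slope. -/
lemma IsTConfig.exists_numbering (hT : IsTConfig d g W) {x : ι} (hx : x ∉ W) :
    ∃ A : Fin (d + 3) → ι, A 0 = x ∧ Function.Injective A ∧ (∀ i, i ∉ W ↔ ∃ a, A a = i) ∧
      ∀ i j k, i < j → j < k → 0 < bracket (g (A i)) (g (A j)) (g (A k)) := by
  classical
  obtain ⟨f, hfx, -, hf⟩ := hT.exists_support hx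
  set s : Finset ι := (Finset.univ \ W).erase x with hs
  have hmem : ∀ i, i ∈ s ↔ i ∉ W ∧ i ≠ x := fun i => by simp [hs, and_comm]
  have hscard : s.card = d + 2 := by
    rw [hs, Finset.card_erase_of_mem (by simpa using hx),
      Finset.card_sdiff_of_subset (Finset.subset_univ _), Finset.card_univ, hT.balanced.1, hT.card]
    omega
  obtain ⟨o, ho⟩ : s.Nonempty := Finset.card_pos.1 (by omega)
  have hfo := hf o ((hmem o).1 ho).1 ((hmem o).1 ho).2
  set key : ι → ℝ := fun i => bracket (g x) (g o) (g i) / f (g i) with hkey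
  have hbr : ∀ b c, bracket (g x) (g b) (g c) * f (g o) =
      bracket (g x) (g o) (g c) * f (g b) - bracket (g x) (g o) (g b) * f (g c) := fun b c => by
    have := cramer_apply f (g x) (g o) (g b) (g c)
    rw [hfx] at this
    linarith
  have hlt : ∀ b ∈ s, ∀ c ∈ s, key b < key c → 0 < bracket (g x) (g b) (g c) :=
    fun b hb c hc h => by
      have hfb := hf b ((hmem b).1 hb).1 ((hmem b).1 hb).2
      have hfc := hf c ((hmem c).1 hc).1 ((hmem c).1 hc).2
      rw [hkey, div_lt_div_iff₀ hfb hfc] at h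
      have := hbr b c
      exact pos_of_mul_pos_left (show 0 < bracket (g x) (g b) (g c) * f (g o) by linarith) hfo.le
  have hinj : Set.InjOn key s := fun b hb c hc h => by
    by_contra hbc
    have hb' := (hmem b).1 hb
    have hc' := (hmem c).1 hc
    have hfb := hf b hb'.1 hb'.2
    have hfc := hf c hc'.1 hc'.2
    simp only [hkey] at h
    rw [div_eq_div_iff hfb.ne' hfc.ne'] at h
    have h0 : bracket (g x) (g b) (g c) * f (g o) = 0 := by rw [hbr, h]; ring
    exact hT.balanced.bracket_ne_zero (Ne.symm hb'.2) (Ne.symm hc'.2) hbc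
      ((mul_eq_zero.1 h0).resolve_right hfo.ne')
  have htcard : (s.image key).card = d + 2 := by rw [Finset.card_image_of_injOn hinj, hscard]
  set e := (s.image key).orderEmbOfFin htcard with he
  have hB : ∀ j, ∃ i ∈ s, key i = e j := fun j => by
    have := Finset.orderEmbOfFin_mem (s.image key) htcard j
    exact Finset.mem_image.1 this
  choose B hBs hBe using hB
  have hBinj : Function.Injective B := fun i j h => e.injective (by rw [← hBe, ← hBe, h])
  have hA : ∀ j k, j < k → 0 < bracket (g x) (g (B j)) (g (B k)) := fun j k hjk =>
    hlt _ (hBs j) _ (hBs k) (by rw [hBe, hBe]; exact e.strictMono hjk)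
  refine ⟨Fin.cons x B, rfl, ?_, fun i => ⟨fun hi => ?_, ?_⟩, fun i j k hij hjk => ?_⟩
  · refine Fin.cons_injective_iff.2 ⟨?_, hBinj⟩
    rintro ⟨j, hj⟩
    exact ((hmem _).1 (hBs j)).2 hj
  · by_cases hix : i = x
    · exact ⟨0, by simp [hix]⟩
    · have himage : Finset.univ.image B = s := Finset.eq_of_subset_of_card_le
        (fun i hi => by
          obtain ⟨j, -, rfl⟩ := Finset.mem_image.1 hi
          exact hBs j)
        (by rw [Finset.card_image_of_injective _ hBinj, hscard]; simp)
      have : i ∈ Finset.univ.image B := himage ▸ (hmem i).2 ⟨hi, hix⟩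
      obtain ⟨j, -, rfl⟩ := Finset.mem_image.1 this
      exact ⟨j.succ, by simp⟩
  · rintro ⟨a, rfl⟩
    refine Fin.cases ?_ (fun j => ?_) a
    · simpa using hx
    · simpa using ((hmem _).1 (hBs j)).1
  · obtain ⟨j, rfl⟩ := Fin.exists_succ_eq.2 (Fin.ne_zero_of_lt hij)
    obtain ⟨k, rfl⟩ := Fin.exists_succ_eq.2 (Fin.ne_zero_of_lt hjk)
    rw [Fin.succ_lt_succ_iff] at hjk
    induction i using Fin.cases with
    | zero => simpa using hA j k hjk
    | succ i =>
      rw [Fin.succ_lt_succ_iff] at hij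
      simp only [Fin.cons_succ]
      -- otherwise the point in the middle would lie in the triangle of the other two and `x`
      by_contra! hle
      have h1 := hA i j hij
      have h2 := hA j k hjk
      have hj' := (hmem _).1 (hBs j)
      obtain ⟨l, hl0, -, hl⟩ := hT.exists_support hj'.1
      have h3 := cramer_apply l (g x) (g (B i)) (g (B j)) (g (B k))
      rw [hl0, mul_zero, add_zero] at h3
      have h4 := mul_nonneg (neg_nonneg.2 hle) (hl x hx hj'.2.symm).le
      have h5 := mul_pos h2 (hl (B i) ((hmem _).1 (hBs i)).1 (hBinj.ne hij.ne))
      have h6 := mul_pos h1 (hl (B k) ((hmem _).1 (hBs k)).1 (hBinj.ne hjk.ne'))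
      linarith

/-- For black points numbered along the boundary, a white point lies in the convex hull of the run
from the first one to `A m` iff it is on the corresponding side of the diagonal that joins the
ends of the run. -/
lemma IsTConfig.exists_cone_run_iff (hT : IsTConfig d g W) {n : ℕ} {A : Fin n → ι}
    (hinj : Function.Injective A) (hAW : ∀ i, i ∉ W ↔ ∃ a, A a = i) {s : SignType} (hs : s ≠ 0)
    (hA : ∀ i j k, i < j → j < k →
      SignType.sign (bracket (g (A i)) (g (A j)) (g (A k))) = s)
    {o m : Fin n} (ho : ∀ i, o ≤ i) (hom : o < m) {w : ι} (hw : w ∈ W) :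
    (∃ c : ι → ℝ, (∀ i, 0 ≤ c i) ∧ (∀ i ∉ A '' Iic m, c i = 0) ∧ ∑ i, c i • g i = -g w) ↔
      SignType.sign (bracket (g (A o)) (g (A m)) (g w)) = s := by
  have hAw : ∀ a, A a ≠ w := fun a h => (hAW (A a)).2 ⟨a, rfl⟩ (h ▸ hw)
  obtain ⟨η, hη⟩ : ∃ η : ℝ, SignType.sign η = s := by
    rcases s with _ | _ | _
    · exact ⟨0, sign_zero⟩
    · exact ⟨-1, sign_neg (by norm_num)⟩
    · exact ⟨1, sign_pos one_pos⟩
  set h : (Fin 3 → ℝ) →ₗ[ℝ] ℝ := η • bracketL (g (A o)) (g (A m)) with hh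
  have hsign : ∀ v, SignType.sign (h v) = s * SignType.sign (bracket (g (A o)) (g (A m)) v) :=
    fun v => by simp only [hh, LinearMap.smul_apply, smul_eq_mul, sign_mul, hη, bracketL_apply]
  have hss : s * s = 1 := by
    have : ∀ s : SignType, s ≠ 0 → s * s = 1 := by decide
    exact this s hs
  have hho : h (g (A o)) = 0 := by simp [hh]
  have hhm : h (g (A m)) = 0 := by simp [hh]
  have hhgt : ∀ l, m < l → 0 < h (g (A l)) := fun l hl => by
    rw [← sign_eq_one_iff, hsign, hA o m l hom hl, hss]
  have hhle : ∀ l, l ≤ m → h (g (A l)) ≤ 0 := fun l hl => by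
    rcases hl.eq_or_lt with rfl | hl
    · exact hhm.le
    rcases (ho l).eq_or_lt with rfl | hol
    · exact hho.le
    refine (sign_eq_neg_one_iff.1 ?_).le
    rw [hsign, bracket_swap_right, Left.sign_neg, hA o l m hol hl, mul_neg, hss]
  have hwne : bracket (g (A o)) (g (A m)) (g w) ≠ 0 :=
    hT.balanced.bracket_ne_zero (hinj.ne hom.ne) (hAw o) (hAw m)
  have hiff : 0 < h (g w) ↔ SignType.sign (bracket (g (A o)) (g (A m)) (g w)) = s := by
    rw [← sign_eq_one_iff, hsign]
    have : ∀ s t : SignType, s ≠ 0 → (s * t = 1 ↔ t = s) := by decide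
    exact this _ _ hs
  rw [← hiff]
  constructor
  · rintro ⟨c, hc0, hcz, hc⟩
    have h1 : ∑ i, c i * h (g i) = -h (g w) := by simpa using congrArg h hc
    have h2 : ∑ i, c i * h (g i) ≤ 0 := Finset.sum_nonpos fun i _ => by
      by_cases hi : i ∈ A '' Iic m
      · obtain ⟨a, ha, rfl⟩ := hi
        exact mul_nonpos_of_nonneg_of_nonpos (hc0 _) (hhle a ha)
      · rw [hcz i hi, zero_mul]
    refine lt_of_le_of_ne (by linarith) fun h0 => ?_
    have := hsign (g w)
    rw [← h0, sign_zero] at this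
    exact mul_ne_zero hs (sign_ne_zero.2 hwne) this.symm
  · intro hw0
    obtain ⟨c, hc0, hcz, hc⟩ := hT.exists_cone_of_chord ((hAW _).2 ⟨o, rfl⟩) ((hAW _).2 ⟨m, rfl⟩)
      (hinj.ne hom.ne) hw hho hhm hw0
    refine ⟨c, hc0, fun i hi => hcz i ?_, hc⟩
    by_cases hiW : i ∈ W
    · exact Or.inl hiW
    · obtain ⟨a, rfl⟩ := (hAW i).1 hiW
      refine Or.inr (hhgt a ?_)
      by_contra! hle
      exact hi ⟨a, hle, rfl⟩

end Lift

/-! ### Equivalence by diagonals and the sides of diagonals -/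

section Compare

variable {ι κ : Type*} [Fintype ι] [Fintype κ] {d : ℕ} {g : ι → Fin 3 → ℝ} {W : Finset ι}
  {g' : κ → Fin 3 → ℝ} {W' : Finset κ} {X : PlaneDiagram ι} {Y : PlaneDiagram κ}

lemma IsLift.exists_sign_of_black {ι : Type*} [Fintype ι] {g : ι → Fin 3 → ℝ} {W : Finset ι}
    {X : PlaneDiagram ι} (hL : IsLift X g W) :
    ∃ s : SignType, s ≠ 0 ∧ ∀ i ∉ W, ∀ j ∉ W, ∀ k ∉ W,
      SignType.sign (bracket (g i) (g j) (g k)) = s * X.orient i j k := by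
  obtain ⟨s, hs, h⟩ := hL.orient
  refine ⟨s, hs, fun i hi j hj k hk => ?_⟩
  rw [h, colour_of_notMem hi, colour_of_notMem hj, colour_of_notMem hk]
  have : ∀ s t : SignType, s ≠ 0 → t = s * (s * 1 * 1 * 1 * t) := by decide
  exact this _ _ hs

/-- An equivalence by diagonals respects the sides of all diagonals. -/
lemma respectsDiagonals_of_isDiagonalIso (hT : IsTConfig d g W) (hL : IsLift X g W)
    (hT' : IsTConfig d g' W') (hL' : IsLift Y g' W') {σ : ι ≃ κ} (hσ : IsDiagonalIso X Y σ) :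
    RespectsDiagonals g W g' W' σ := by
  classical
  obtain ⟨hcol, hnum, hrun⟩ := hσ
  have hW : ∀ i, σ i ∈ W' ↔ i ∈ W := fun i => by
    have := hcol i
    rw [hL.mem_black_iff, hL'.mem_black_iff] at this
    exact not_iff_not.1 this
  obtain ⟨δ, hδ, hδX⟩ := hL.exists_sign_of_black
  obtain ⟨δ', hδ', hδY⟩ := hL'.exists_sign_of_black
  have hlocal : ∀ x, ∃ s : SignType, s ≠ 0 ∧ (x ∉ W → ∀ y ∉ W, ∀ k,
      SignType.sign (bracket (g' (σ x)) (g' (σ y)) (g' (σ k))) =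
        s * SignType.sign (bracket (g x) (g y) (g k))) := fun x => by
    by_cases hx : x ∈ W
    · exact ⟨1, by decide, fun h => absurd hx h⟩
    obtain ⟨A, rfl, hinj, hAW, hA⟩ := hT.exists_numbering hx
    have hAb : ∀ a, A a ∉ W := fun a => (hAW _).2 ⟨a, rfl⟩
    have hAb' : ∀ a, (σ ∘ A) a ∉ W' := fun a => by
      rw [Function.comp_apply, hW]; exact hAb a
    have hnumX : IsBoundaryNumbering X A := by
      refine ⟨hinj, by ext i; rw [hL.mem_black_iff, hAW]; rfl, ?_⟩
      have hor : ∀ i j k, i < j → j < k → δ * X.orient (A i) (A j) (A k) = 1 :=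
        fun i j k hij hjk => by
          rw [← hδX _ (hAb i) _ (hAb j) _ (hAb k), sign_pos (hA i j k hij hjk)]
      have h3 : δ = 1 ∨ δ = -1 := by
        have : ∀ s : SignType, s ≠ 0 → s = 1 ∨ s = -1 := by decide
        exact this δ hδ
      rcases h3 with rfl | rfl
      · exact Or.inl fun i j k hij hjk => by simpa using hor i j k hij hjk
      · exact Or.inr fun i j k hij hjk => by
          have := hor i j k hij hjk
          rw [neg_one_mul] at this
          rw [← this, neg_neg]
    obtain ⟨hinj', -, hor'⟩ := (hnum _ A).1 hnumX
    obtain ⟨s, hs, hsA⟩ : ∃ s : SignType, s ≠ 0 ∧ ∀ i j k, i < j → j < k →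
        SignType.sign (bracket (g' ((σ ∘ A) i)) (g' ((σ ∘ A) j)) (g' ((σ ∘ A) k))) = s := by
      rcases hor' with h | h
      · refine ⟨δ', hδ', fun i j k hij hjk => ?_⟩
        rw [hδY _ (hAb' i) _ (hAb' j) _ (hAb' k), h i j k hij hjk, mul_one]
      · refine ⟨-δ', by simpa using hδ', fun i j k hij hjk => ?_⟩
        rw [hδY _ (hAb' i) _ (hAb' j) _ (hAb' k), h i j k hij hjk, mul_neg_one]
    refine ⟨s, hs, fun _ y hy k => ?_⟩
    obtain ⟨m, rfl⟩ := (hAW y).1 hy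
    by_cases hm : m = 0
    · simp [hm]
    have hm0 : 0 < m := Fin.pos_iff_ne_zero.2 hm
    by_cases hk : k ∈ W
    · have hAW' : ∀ i, i ∉ W' ↔ ∃ a, (σ ∘ A) a = i := fun i => by
        obtain ⟨i, rfl⟩ := σ.surjective i
        rw [hW, hAW]; simp
      have h1 := hT.exists_cone_run_iff hinj hAW (s := 1) (by decide)
        (fun i j k hij hjk => sign_pos (hA i j k hij hjk)) (o := 0) (fun i => Fin.zero_le i) hm0 hk
      have h2 := hT'.exists_cone_run_iff hinj' hAW' hs hsA (o := 0) (fun i => Fin.zero_le i) hm0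
        ((hW k).2 hk)
      rw [← hL.mem_convexHull_iff k hk _ (by rintro _ ⟨a, -, rfl⟩; exact hAb a)] at h1
      rw [← hL'.mem_convexHull_iff _ ((hW k).2 hk) _ (by rintro _ ⟨a, -, rfl⟩; exact hAb' a),
        image_comp, ← hrun _ A hnumX m k (by rw [hL.mem_black_iff]; simpa using hk), h1] at h2
      have hne : ∀ a, A a ≠ k := fun a h => hAb a (h ▸ hk)
      have h3 : SignType.sign (bracket (g (A 0)) (g (A m)) (g k)) ≠ 0 :=
        sign_ne_zero.2 (hT.balanced.bracket_ne_zero (hinj.ne hm0.ne) (hne 0) (hne m))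
      have h4 : SignType.sign (bracket (g' (σ (A 0))) (g' (σ (A m))) (g' (σ k))) ≠ 0 :=
        sign_ne_zero.2 (hT'.balanced.bracket_ne_zero (hinj'.ne hm0.ne) (σ.injective.ne (hne 0))
          (σ.injective.ne (hne m)))
      have hdec : ∀ s t u : SignType, s ≠ 0 → t ≠ 0 → u ≠ 0 → (t = 1 ↔ u = s) → u = s * t := by
        decide
      exact hdec _ _ _ hs h3 h4 h2
    · obtain ⟨l, rfl⟩ := (hAW k).1 hk
      rcases lt_trichotomy l m with hl | rfl | hl
      · by_cases hl0 : l = 0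
        · simp [hl0]
        have hl0' : 0 < l := Fin.pos_iff_ne_zero.2 hl0
        have h1 := hsA 0 l m hl0' hl
        simp only [Function.comp_apply] at h1
        rw [bracket_swap_right, bracket_swap_right (g (A 0)), Left.sign_neg, Left.sign_neg, h1,
          sign_pos (hA 0 l m hl0' hl), mul_neg_one]
      · simp
      · have h1 := hsA 0 m l hm0 hl
        simp only [Function.comp_apply] at h1
        rw [h1, sign_pos (hA 0 m l hm0 hl), mul_one]
  choose ε hε0 hε using hlocal
  obtain ⟨o, ho⟩ := hT.exists_notMem
  refine ⟨hW, ε o, hε0 o, fun i hi j hj k => ?_⟩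
  suffices h : ε i = ε o by rw [hε i hi j hj k, h]
  by_cases hio : i = o
  · rw [hio]
  obtain ⟨l, hl⟩ := hT.balanced.exists_notMem (insert i (insert o W)) (by
    have h1 := Finset.card_insert_le i (insert o W)
    have h2 := Finset.card_insert_le o W
    have h3 := hT.card
    omega)
  simp only [Finset.mem_insert, not_or] at hl
  have h1 := hε i hi o ho l
  have h2 := hε o ho i hi l
  rw [bracket_swap, bracket_swap (g i), Left.sign_neg, Left.sign_neg, mul_neg] at h2
  refine mul_right_cancel₀ (sign_ne_zero.2 (hT.balanced.bracket_ne_zero hio (Ne.symm hl.1)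
    (Ne.symm hl.2.1))) (h1.symm.trans (neg_injective h2))

/-- A bijection that respects the sides of diagonals respects the convex hulls of black points. -/
lemma RespectsDiagonals.exists_cone {σ : ι ≃ κ} (hσ : RespectsDiagonals g W g' W' σ)
    (hT : IsTConfig d g W) (hT' : IsTConfig d g' W') {b : ι} {S : Set ι}
    (h : ∃ c : ι → ℝ, (∀ i, 0 ≤ c i) ∧ (∀ i ∉ S, c i = 0) ∧ ∑ i, c i • g i = -g b) :
    ∃ c : κ → ℝ, (∀ i, 0 ≤ c i) ∧ (∀ i ∉ σ '' S, c i = 0) ∧ ∑ i, c i • g' i = -g' (σ b) := by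
  classical
  obtain ⟨c, hc0, hcS, hc⟩ := h
  obtain ⟨i, j, k, hne, hi, hj, hk, hcof⟩ := hT.balanced.exists_isCofacet (u := b)
    (c + Pi.single b 1) (fun i => by
      rw [Pi.add_apply, Pi.single_apply]
      have := hc0 i
      split_ifs <;> linarith)
    (by simpa using add_pos_of_nonneg_of_pos (hc0 b) one_pos)
    (by simp [add_smul, Finset.sum_add_distrib, hc, Pi.single_apply, ite_smul])
  have hS : ∀ i, b ≠ i → 0 < (c + Pi.single b 1 : ι → ℝ) i → i ∈ S := fun i hbi hi => by
    by_contra hiS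
    simp [hcS i hiS, Ne.symm hbi] at hi
  have hiS := hS i hne.1 hi
  have hjS := hS j hne.2.1 hj
  have hkS := hS k hne.2.2.1 hk
  obtain ⟨p, q, r, t, hp, hq, hr, ht, hdep⟩ := hσ.isCofacet hT hT' hne hcof
  refine ⟨Pi.single (σ i) (q / p) + Pi.single (σ j) (r / p) + Pi.single (σ k) (t / p),
    fun x => ?_, fun x hx => ?_, ?_⟩
  · simp only [Pi.add_apply, Pi.single_apply]
    split_ifs <;> positivity
  · have h1 : ∀ l ∈ S, x ≠ σ l := fun l hl h => hx ⟨l, hl, h.symm⟩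
    simp [h1 i hiS, h1 j hjS, h1 k hkS]
  · have h1 : p⁻¹ • (p • g' (σ b) + q • g' (σ i) + r • g' (σ j) + t • g' (σ k)) = 0 := by
      rw [hdep, smul_zero]
    simp only [smul_add, smul_smul, inv_mul_cancel₀ hp.ne', one_smul, inv_mul_eq_div] at h1
    simp only [Pi.add_apply, add_smul, Finset.sum_add_distrib, Pi.single_apply, ite_smul, zero_smul,
      Finset.sum_ite_eq', Finset.mem_univ, if_true]
    rw [eq_neg_iff_add_eq_zero, ← h1]
    abel

/-- A colour preserving isomorphism of oriented matroids is an equivalence of diagrams in both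
senses. -/
lemma isDiagramIso_and_isDiagonalIso (hT : IsTConfig d g W) (hL : IsLift X g W)
    (hT' : IsTConfig d g' W') (hL' : IsLift Y g' W') {σ : ι ≃ κ} (hW : ∀ i, σ i ∈ W' ↔ i ∈ W)
    {s : SignType} (hs : s ≠ 0)
    (h : ∀ i j k, SignType.sign (bracket (g' (σ i)) (g' (σ j)) (g' (σ k))) =
      s * SignType.sign (bracket (g i) (g j) (g k))) :
    IsDiagramIso X Y σ ∧ IsDiagonalIso X Y σ := by
  classical
  have hσ : RespectsDiagonals g W g' W' σ := ⟨hW, s, hs, fun i _ j _ k => h i j k⟩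
  have hcol : ∀ i, σ i ∈ Y.black ↔ i ∈ X.black := fun i => by
    rw [hL.mem_black_iff, hL'.mem_black_iff, hW]
  have hcolour : ∀ i, colour W' (σ i) = colour W i := fun i => by simp [colour, hW]
  have hor : (∀ i j k, Y.orient (σ i) (σ j) (σ k) = X.orient i j k) ∨
      (∀ i j k, Y.orient (σ i) (σ j) (σ k) = -X.orient i j k) := by
    obtain ⟨δ, hδ, hX⟩ := hL.orient
    obtain ⟨δ', hδ', hY⟩ := hL'.orient
    have hdec : ∀ s δ δ' : SignType, s ≠ 0 → δ ≠ 0 → δ' ≠ 0 → δ' * s = δ ∨ δ' * s = -δ := by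
      decide
    rcases hdec s δ δ' hs hδ hδ' with h1 | h1
    · refine Or.inl fun i j k => ?_
      rw [hX, hY, h, hcolour, hcolour, hcolour, ← h1]
      ac_rfl
    · refine Or.inr fun i j k => ?_
      rw [hX, hY, h, hcolour, hcolour, hcolour]
      rw [show δ = -(δ' * s) by rw [h1, neg_neg]]
      simp only [neg_mul, neg_neg]
      ac_rfl
  refine ⟨⟨hcol, hor, fun i j k => ?_⟩, hcol, fun n A => ?_, fun n A hA m b hb => ?_⟩
  · rw [hL.wbtw_iff hT.balanced, hL'.wbtw_iff hT'.balanced, σ.injective.eq_iff,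
      σ.injective.eq_iff]
  · have hrange : range (σ ∘ A) = Y.black ↔ range A = X.black := by
      have himage : σ '' X.black = Y.black := by
        ext k
        obtain ⟨i, rfl⟩ := σ.surjective k
        rw [σ.injective.mem_set_image, hcol]
      rw [range_comp, ← himage, σ.injective.image_injective.eq_iff]
    rw [IsBoundaryNumbering, IsBoundaryNumbering, hrange, σ.injective.of_comp_iff]
    refine and_congr_right fun _ => and_congr_right fun _ => ?_
    simp only [Function.comp_apply]
    rcases hor with h1 | h1
    · simp only [h1]
    · simp only [h1, neg_inj, neg_eq_iff_eq_neg (b := (1 : SignType))]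
      exact or_comm
  · rw [hL.mem_black_iff, not_not] at hb
    have hAb : ∀ i ∈ A '' Iic m, i ∉ W := by
      rintro _ ⟨a, -, rfl⟩
      rw [← hL.mem_black_iff, ← hA.2.1]
      exact mem_range_self a
    rw [hL.mem_convexHull_iff b hb _ hAb, hL'.mem_convexHull_iff _ ((hW b).2 hb) _ (by
      rintro _ ⟨i, hi, rfl⟩; rw [hW]; exact hAb i hi)]
    refine ⟨hσ.exists_cone hT hT', fun h => ?_⟩
    have := hσ.symm.exists_cone hT' hT (b := σ b) (S := σ '' (A '' Iic m)) h
    rwa [σ.symm_image_image, σ.symm_apply_apply] at this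

end Compare

/-! ### Isomorphisms of T-polytopes -/

section Main

variable {ι κ : Type*} [Fintype ι] [Fintype κ] {d : ℕ} {g : ι → Fin 3 → ℝ} {W : Finset ι}
  {g' : κ → Fin 3 → ℝ} {W' : Finset κ}

lemma isPolytopeIso_iff {D E m n : ℕ} {p : ι → Fin D → ℝ} {q : κ → Fin E → ℝ}
    {g : ι → Fin m → ℝ} {g' : κ → Fin n → ℝ} (hg : IsGaleTransform p g)
    (hg' : IsGaleTransform q g') {σ : ι ≃ κ} :
    IsPolytopeIso p q σ ↔ ∀ M : Set ι, IsGaleFace g M ↔ IsGaleFace g' (σ '' M) :=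
  forall_congr' fun _ => by
    rw [isFaceVertexSet_iff_isGaleFace hg, isFaceVertexSet_iff_isGaleFace hg']

/-- A bijection that respects faces respects missing faces with `d + 1` vertices. -/
lemma isCut_empty_map_iff (hg : IsBalanced d g) (hg' : IsBalanced d g') {σ : ι ≃ κ}
    (hσ : ∀ M : Set ι, IsGaleFace g M ↔ IsGaleFace g' (σ '' M)) (A : Finset ι)
    (hA : A.card = d + 1) : IsCut g ∅ A ↔ IsCut g' ∅ (A.map σ.toEmbedding) := by
  rw [hg.isCut_empty_iff hA, hg'.isCut_empty_iff (by simpa using hA), hσ, Finset.coe_map]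
  rfl

/-- For `d ≥ 2` isomorphisms respect colours. -/
lemma mem_iff_of_two_le (hd : 2 ≤ d) (hT : IsTConfig d g W) (hT' : IsTConfig d g' W') {σ : ι ≃ κ}
    (hσ : ∀ M : Set ι, IsGaleFace g M ↔ IsGaleFace g' (σ '' M)) (i : ι) : σ i ∈ W' ↔ i ∈ W := by
  have hmap : (W'.map σ.symm.toEmbedding).map σ.toEmbedding = W' := by
    ext k; simp
  have hcard : (W'.map σ.symm.toEmbedding).card = d + 1 := by simpa using hT'.card
  have hpull : IsTConfig d g (W'.map σ.symm.toEmbedding) := by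
    refine ⟨hT.balanced, hcard, fun u hu => ?_⟩
    rw [isCut_map_iff hT.balanced hT'.balanced
      (isCut_empty_map_iff hT.balanced hT'.balanced hσ) _ (by simp) _ hcard, hmap,
      Finset.map_singleton]
    exact hT'.cut _ (by simpa [Equiv.symm_apply_eq] using hu)
  rw [hT.eq_of_two_le hd hpull]
  simp

/-! ### Hexagons -/

/-- In a T-diagram with four black points `0, 1, 2, 3` in cyclic order and two white points, numbered
suitably, this is the sign of the determinant of the vectors of the black points `a < b` and of the
white point `r`. -/
def hexagonSide (a b : Fin 4) (r : Fin 2) : SignType :=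
  if a = 0 ∧ b = 2 ∨ a = 1 ∧ b = 3 then (if r = 0 then 1 else -1)
  else if a = 0 ∧ b = 3 then 1 else -1

/-- All points of a T-diagram with six points lie in the same way: the white points lie in opposite
ones of the four triangles into which the diagonals divide the quadrilateral. -/
lemma IsTConfig.exists_hexagon (hT : IsTConfig 1 g W) :
    ∃ e : Fin 4 ⊕ Fin 2 ≃ ι, (∀ a, e (Sum.inl a) ∉ W) ∧ (∀ r, e (Sum.inr r) ∈ W) ∧
      (∀ a b c, a < b → b < c →
        0 < bracket (g (e (Sum.inl a))) (g (e (Sum.inl b))) (g (e (Sum.inl c)))) ∧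
      ∀ a b, a < b → ∀ r,
        SignType.sign (bracket (g (e (Sum.inl a))) (g (e (Sum.inl b))) (g (e (Sum.inr r)))) =
          hexagonSide a b r := by
  classical
  -- an edge of the quadrilateral has the white points on its inner side
  have hedge : ∀ {x y z t : ι}, (∀ i, i ∉ W → i = x ∨ i = y ∨ i = z ∨ i = t) → x ∉ W → y ∉ W →
      x ≠ y → ∀ η : ℝ, 0 < η * bracket (g x) (g y) (g z) → 0 < η * bracket (g x) (g y) (g t) →
      ∀ w ∈ W, η * bracket (g x) (g y) (g w) < 0 := by
    intro x y z t hb hx hy hxy η hz ht w hw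
    by_contra! hge
    set h := η • bracketL (g x) (g y) with hh
    have hh0 : h ≠ 0 := fun h0 => by
      have : h (g z) = 0 := by rw [h0]; rfl
      exact hz.ne' (by simpa [hh] using this)
    have := hT.balanced.le_card_of_neg hh0 (s := W.erase w) fun i hi => by
      simp only [hh, LinearMap.smul_apply, bracketL_apply, smul_eq_mul] at hi
      rw [Finset.mem_erase]
      refine ⟨fun h => by rw [h] at hi; exact hge.not_gt hi, ?_⟩
      by_contra hiW
      rcases hb i hiW with rfl | rfl | rfl | rfl
      · simp at hi
      · simp at hi
      · exact hz.not_gt hi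
      · exact ht.not_gt hi
    rw [Finset.card_erase_of_mem hw, hT.card] at this
    omega
  -- a diagonal of the quadrilateral has one white point on either side
  have hdiag : ∀ {x y z t : ι}, (∀ i, i ∉ W → i = x ∨ i = y ∨ i = z ∨ i = t) → x ∉ W → y ∉ W →
      x ≠ y → ∀ η : ℝ, η ≠ 0 → η * bracket (g x) (g y) (g z) < 0 →
      0 < η * bracket (g x) (g y) (g t) → ∃ w ∈ W, η * bracket (g x) (g y) (g w) < 0 := by
    intro x y z t hb hx hy hxy η hη hz ht
    by_contra! hle
    set h := η • bracketL (g x) (g y) with hh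
    have hh0 : h ≠ 0 := fun h0 => by
      have : h (g z) = 0 := by rw [h0]; rfl
      exact hz.ne (by simpa [hh] using this)
    have := hT.balanced.le_card_of_neg hh0 (s := {z}) fun i hi => by
      simp only [hh, LinearMap.smul_apply, bracketL_apply, smul_eq_mul] at hi
      by_cases hiW : i ∈ W
      · exact absurd hi (hle i hiW).not_gt
      rcases hb i hiW with rfl | rfl | rfl | rfl
      · simp at hi
      · simp at hi
      · simp
      · exact absurd hi ht.not_gt
    simp at this
  -- it remains to number the points suitably
  have hfinish : ∀ (A : Fin 4 → ι) (b c : ι), Function.Injective A → (∀ i, i ∉ W ↔ ∃ a, A a = i) →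
      (∀ i j k, i < j → j < k → 0 < bracket (g (A i)) (g (A j)) (g (A k))) → b ∈ W → c ∈ W →
      0 < bracket (g (A 0)) (g (A 2)) (g b) → bracket (g (A 0)) (g (A 2)) (g c) < 0 →
      0 < bracket (g (A 1)) (g (A 3)) (g b) → bracket (g (A 1)) (g (A 3)) (g c) < 0 →
      ∃ e : Fin 4 ⊕ Fin 2 ≃ ι, (∀ a, e (Sum.inl a) ∉ W) ∧ (∀ r, e (Sum.inr r) ∈ W) ∧
      (∀ a b c, a < b → b < c →
        0 < bracket (g (e (Sum.inl a))) (g (e (Sum.inl b))) (g (e (Sum.inl c)))) ∧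
      ∀ a b, a < b → ∀ r,
        SignType.sign (bracket (g (e (Sum.inl a))) (g (e (Sum.inl b))) (g (e (Sum.inr r)))) =
          hexagonSide a b r := by
    intro A b c hinj hAW hA hb hc h02b h02c h13b h13c
    have hbc : b ≠ c := by rintro rfl; exact h02b.not_gt h02c
    have hAb : ∀ a, A a ∉ W := fun a => (hAW _).2 ⟨a, rfl⟩
    have hcw : ∀ r, (![b, c] : Fin 2 → ι) r ∈ W := by
      intro r; fin_cases r
      · exact hb
      · exact hc
    have hblack : ∀ i, i ∉ W → i = A 0 ∨ i = A 1 ∨ i = A 2 ∨ i = A 3 := fun i hi => by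
      obtain ⟨a, rfl⟩ := (hAW i).1 hi
      fin_cases a <;> simp
    have hbij : Function.Bijective (Sum.elim A ![b, c]) := by
      rw [Fintype.bijective_iff_injective_and_card]
      refine ⟨Function.Injective.sumElim hinj ?_ fun a r h => hAb a (h ▸ hcw r), ?_⟩
      · intro r s; fin_cases r <;> fin_cases s <;> simp [hbc, hbc.symm]
      · rw [hT.balanced.1]; simp
    refine ⟨Equiv.ofBijective _ hbij, hAb, hcw, hA, ?_⟩
    have h01 : ∀ w ∈ W, bracket (g (A 0)) (g (A 1)) (g w) < 0 := fun w hw => by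
      simpa using hedge (x := A 0) (y := A 1) (z := A 2) (t := A 3)
        (fun i hi => by have := hblack i hi; tauto) (hAb 0) (hAb 1) (hinj.ne (by decide)) 1
        (by simpa using hA 0 1 2 (by decide) (by decide))
        (by simpa using hA 0 1 3 (by decide) (by decide)) w hw
    have h12 : ∀ w ∈ W, bracket (g (A 1)) (g (A 2)) (g w) < 0 := fun w hw => by
      simpa using hedge (x := A 1) (y := A 2) (z := A 0) (t := A 3)
        (fun i hi => by have := hblack i hi; tauto) (hAb 1) (hAb 2) (hinj.ne (by decide)) 1
        (by rw [bracket_rotate]; simpa using hA 0 1 2 (by decide) (by decide))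
        (by simpa using hA 1 2 3 (by decide) (by decide)) w hw
    have h23 : ∀ w ∈ W, bracket (g (A 2)) (g (A 3)) (g w) < 0 := fun w hw => by
      simpa using hedge (x := A 2) (y := A 3) (z := A 0) (t := A 1)
        (fun i hi => by have := hblack i hi; tauto) (hAb 2) (hAb 3) (hinj.ne (by decide)) 1
        (by rw [bracket_rotate]; simpa using hA 0 2 3 (by decide) (by decide))
        (by rw [bracket_rotate]; simpa using hA 1 2 3 (by decide) (by decide)) w hw
    have h03 : ∀ w ∈ W, 0 < bracket (g (A 0)) (g (A 3)) (g w) := fun w hw => by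
      simpa using hedge (x := A 0) (y := A 3) (z := A 1) (t := A 2)
        (fun i hi => by have := hblack i hi; tauto) (hAb 0) (hAb 3) (hinj.ne (by decide)) (-1)
        (by rw [bracket_swap_right]; simpa using hA 0 1 3 (by decide) (by decide))
        (by rw [bracket_swap_right]; simpa using hA 0 2 3 (by decide) (by decide)) w hw
    intro a a' haa' r
    change SignType.sign (bracket (g (A a)) (g (A a')) (g ((![b, c] : Fin 2 → ι) r))) = _
    have hr := hcw r
    fin_cases a <;> fin_cases a' <;> first | exact absurd haa' (by decide) | skip
    · exact sign_neg (h01 _ hr)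
    · fin_cases r
      · exact sign_pos h02b
      · exact sign_neg h02c
    · exact sign_pos (h03 _ hr)
    · exact sign_neg (h12 _ hr)
    · fin_cases r
      · exact sign_pos h13b
      · exact sign_neg h13c
    · exact sign_neg (h23 _ hr)
  obtain ⟨x, hx⟩ := hT.exists_notMem
  obtain ⟨A, -, hinj, hAW, hA⟩ := hT.exists_numbering hx
  have hAb : ∀ a, A a ∉ W := fun a => (hAW _).2 ⟨a, rfl⟩
  have hblack : ∀ i, i ∉ W → i = A 0 ∨ i = A 1 ∨ i = A 2 ∨ i = A 3 := fun i hi => by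
    obtain ⟨a, rfl⟩ := (hAW i).1 hi
    fin_cases a <;> simp
  have h021 : bracket (g (A 0)) (g (A 2)) (g (A 1)) < 0 := by
    rw [bracket_swap_right]; simpa using hA 0 1 2 (by decide) (by decide)
  have h132 : bracket (g (A 1)) (g (A 3)) (g (A 2)) < 0 := by
    rw [bracket_swap_right]; simpa using hA 1 2 3 (by decide) (by decide)
  have h023 := hA 0 2 3 (by decide) (by decide)
  have h130 : 0 < bracket (g (A 1)) (g (A 3)) (g (A 0)) := by
    rw [bracket_rotate]; exact hA 0 1 3 (by decide) (by decide)
  obtain ⟨c, hc, h02c⟩ := hdiag (x := A 0) (y := A 2) (z := A 1) (t := A 3)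
    (fun i hi => by have := hblack i hi; tauto) (hAb 0) (hAb 2) (hinj.ne (by decide)) 1 one_ne_zero
    (by simpa using h021) (by simpa using h023)
  obtain ⟨b, hb, h02b⟩ := hdiag (x := A 0) (y := A 2) (z := A 3) (t := A 1)
    (fun i hi => by have := hblack i hi; tauto) (hAb 0) (hAb 2) (hinj.ne (by decide)) (-1)
    (by norm_num) (by simpa using h023) (by simpa using h021)
  rw [one_mul] at h02c
  rw [neg_one_mul, neg_lt_zero] at h02b
  have hbc : b ≠ c := by rintro rfl; exact h02b.not_gt h02c
  have hWbc : ∀ w ∈ W, w = b ∨ w = c := fun w hw => by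
    have h1 : ({b, c} : Finset ι) = W := Finset.eq_of_subset_of_card_le
      (by simp [Finset.insert_subset_iff, hb, hc]) (by rw [hT.card, Finset.card_pair hbc])
    simpa [← h1] using hw
  obtain ⟨c', hc', h13c⟩ := hdiag (x := A 1) (y := A 3) (z := A 2) (t := A 0)
    (fun i hi => by have := hblack i hi; tauto) (hAb 1) (hAb 3) (hinj.ne (by decide)) 1 one_ne_zero
    (by simpa using h132) (by simpa using h130)
  obtain ⟨b', hb', h13b⟩ := hdiag (x := A 1) (y := A 3) (z := A 0) (t := A 2)
    (fun i hi => by have := hblack i hi; tauto) (hAb 1) (hAb 3) (hinj.ne (by decide)) (-1)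
    (by norm_num) (by simpa using h130) (by simpa using h132)
  rw [one_mul] at h13c
  rw [neg_one_mul, neg_lt_zero] at h13b
  have hbc' : b' ≠ c' := by rintro rfl; exact h13b.not_gt h13c
  rcases hWbc b' hb' with rfl | rfl
  · obtain rfl : c' = c := (hWbc c' hc').resolve_left hbc'.symm
    exact hfinish A b' c' hinj hAW hA hb hc h02b h02c h13b h13c
  · obtain rfl : c' = b := (hWbc c' hc').resolve_right hbc'.symm
    -- start the numbering at the next black point
    refine hfinish ![A 1, A 2, A 3, A 0] b' c' ?_ (fun i => ?_) ?_ hc hb h13b h13c ?_ ?_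
    · intro i j h
      fin_cases i <;> fin_cases j <;> first | rfl | exact absurd (hinj h) (by decide)
    · rw [hAW]
      constructor
      · rintro ⟨a, rfl⟩
        fin_cases a
        · exact ⟨3, rfl⟩
        · exact ⟨0, rfl⟩
        · exact ⟨1, rfl⟩
        · exact ⟨2, rfl⟩
      · rintro ⟨a, rfl⟩
        fin_cases a <;> exact ⟨_, rfl⟩
    · intro i j k hij hjk
      fin_cases i <;> fin_cases j <;> fin_cases k <;>
        first
        | exact absurd hij (by decide)
        | exact absurd hjk (by decide)
        | exact hA 1 2 3 (by decide) (by decide)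
        | skip
      · exact (bracket_rotate _ _ _).trans_gt (hA 0 1 2 (by decide) (by decide))
      · exact (bracket_rotate _ _ _).trans_gt (hA 0 1 3 (by decide) (by decide))
      · exact (bracket_rotate _ _ _).trans_gt (hA 0 2 3 (by decide) (by decide))
    · change 0 < bracket (g (A 2)) (g (A 0)) (g b')
      rw [bracket_swap]; linarith
    · change bracket (g (A 2)) (g (A 0)) (g c') < 0
      rw [bracket_swap]; linarith

lemma exists_respectsDiagonals_of_hexagon (hT : IsTConfig 1 g W) (hT' : IsTConfig 1 g' W') :
    ∃ σ : ι ≃ κ, RespectsDiagonals g W g' W' σ := by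
  obtain ⟨e, hb, hw, hA, hside⟩ := hT.exists_hexagon
  obtain ⟨e', hb', hw', hA', hside'⟩ := hT'.exists_hexagon
  have hlt : ∀ a b, a < b → ∀ k,
      SignType.sign (bracket (g' (e' (Sum.inl a))) (g' (e' (Sum.inl b))) (g' (e' k))) =
        SignType.sign (bracket (g (e (Sum.inl a))) (g (e (Sum.inl b))) (g (e k))) := by
    rintro a b hab (c | r)
    · rcases lt_trichotomy c a with h | rfl | h
      · rw [bracket_rotate, bracket_rotate (g (e (Sum.inl c))), sign_pos (hA c a b h hab),
          sign_pos (hA' c a b h hab)]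
      · simp
      · rcases lt_trichotomy c b with h' | rfl | h'
        · rw [bracket_swap_right, bracket_swap_right (g (e (Sum.inl a))), Left.sign_neg,
            Left.sign_neg, sign_pos (hA a c b h h'), sign_pos (hA' a c b h h')]
        · simp
        · rw [sign_pos (hA a b c hab h'), sign_pos (hA' a b c hab h')]
    · rw [hside a b hab, hside' a b hab]
  refine ⟨e.symm.trans e', fun i => ?_, 1, by decide, fun i hi j hj k => ?_⟩
  · obtain ⟨a | r, rfl⟩ := e.surjective i
    · simp [hb, hb']
    · simp [hw, hw']
  · obtain ⟨a | r, rfl⟩ := e.surjective i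
    swap
    · exact absurd (hw r) hi
    obtain ⟨b | r, rfl⟩ := e.surjective j
    swap
    · exact absurd (hw r) hj
    obtain ⟨k, rfl⟩ := e.surjective k
    simp only [Equiv.trans_apply, Equiv.symm_apply_apply, one_mul]
    rcases lt_trichotomy a b with h | rfl | h
    · exact hlt a b h k
    · simp
    · rw [bracket_swap, bracket_swap (g (e (Sum.inl b))), Left.sign_neg, Left.sign_neg, hlt b a h k]

/-- A point is not a polytope with four vertices. -/
lemma pos_of_isTPolytopeWithDiagram {p : ι → Fin (2 * d) → ℝ} {X : PlaneDiagram ι}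
    (hX : IsTPolytopeWithDiagram d p X) : 0 < d := by
  by_contra! h
  obtain rfl : d = 0 := by omega
  have hinj := hX.1.1.2.1.injective
  have hsub : Subsingleton ι := ⟨fun i j => hinj (by ext k; exact k.elim0)⟩
  have h1 := hX.2.1.1
  rw [Nat.card_eq_fintype_card] at h1
  have := Fintype.card_le_one_iff_subsingleton.2 hsub
  omega

end Main

end GaleDiagram

open GaleDiagram

theorem mainTheorem2 {ι κ : Type*} [Fintype ι] [Fintype κ] (d e : ℕ)
    (p : ι → Fin (2 * d) → ℝ) (X : PlaneDiagram ι) (hX : IsTPolytopeWithDiagram d p X)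
    (q : κ → Fin (2 * e) → ℝ) (Y : PlaneDiagram κ) (hY : IsTPolytopeWithDiagram e q Y) :
    ((∃ σ : ι ≃ κ, IsPolytopeIso p q σ) → ∃ σ : ι ≃ κ, IsDiagramIso X Y σ) ∧
    ((∃ σ : ι ≃ κ, IsPolytopeIso p q σ) → ∃ σ : ι ≃ κ, IsDiagonalIso X Y σ) ∧
    (∀ σ : ι ≃ κ, IsDiagonalIso X Y σ → IsPolytopeIso p q σ) ∧
    (2 ≤ d → ∀ σ : ι ≃ κ, IsPolytopeIso p q σ →
      IsDiagramIso X Y σ ∧ IsDiagonalIso X Y σ) := by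
  have hde : (ι ≃ κ) → d = e := fun σ => by
    have h1 := hX.2.1.1
    have h2 := hY.2.1.1
    have h3 := Nat.card_congr σ
    omega
  obtain ⟨g, W, hg, hT, hL⟩ := exists_isLift hX
  obtain ⟨g', W', hg', hT', hL'⟩ := exists_isLift hY
  -- isomorphisms of polytopes that respect colours are isomorphisms of diagrams
  have hiso : ∀ σ : ι ≃ κ, IsPolytopeIso p q σ → (∀ i, σ i ∈ W' ↔ i ∈ W) →
      IsDiagramIso X Y σ ∧ IsDiagonalIso X Y σ := fun σ hσ hW => by
    obtain rfl := hde σ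
    obtain ⟨s, hs, h⟩ := exists_sign_bracket hT.balanced hT'.balanced
      (isCut_empty_map_iff hT.balanced hT'.balanced ((isPolytopeIso_iff hg hg').1 hσ))
    exact isDiagramIso_and_isDiagonalIso hT hL hT' hL' hW hs h
  have hlarge : 2 ≤ d → ∀ σ : ι ≃ κ, IsPolytopeIso p q σ →
      IsDiagramIso X Y σ ∧ IsDiagonalIso X Y σ := fun hd σ hσ => by
    obtain rfl := hde σ
    exact hiso σ hσ (mem_iff_of_two_le hd hT hT' ((isPolytopeIso_iff hg hg').1 hσ))
  have hexists : (∃ σ : ι ≃ κ, IsPolytopeIso p q σ) →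
      ∃ σ : ι ≃ κ, IsDiagramIso X Y σ ∧ IsDiagonalIso X Y σ := by
    rintro ⟨σ, hσ⟩
    obtain rfl := hde σ
    rcases Nat.lt_or_ge d 2 with hd | hd
    · -- a hexagon has more symmetries than its diagram, so `σ` itself need not respect colours
      obtain rfl : d = 1 := by
        have := pos_of_isTPolytopeWithDiagram hX
        omega
      obtain ⟨τ, hτ⟩ := exists_respectsDiagonals_of_hexagon hT hT'
      exact ⟨τ, hiso τ ((isPolytopeIso_iff hg hg').2 fun M => hτ.isGaleFace_iff hT hT') hτ.1⟩
    · exact ⟨σ, hlarge hd σ hσ⟩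
  refine ⟨fun h => (hexists h).imp fun _ h => h.1, fun h => (hexists h).imp fun _ h => h.2,
    fun σ hσ => ?_, hlarge⟩
  obtain rfl := hde σ
  exact (isPolytopeIso_iff hg hg').2 fun M =>
    (respectsDiagonals_of_isDiagonalIso hT hL hT' hL' hσ).isGaleFace_iff hT hT'
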